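/- For real numbers $\beta>1$ and $x\in[0,1]$ put $T_\beta(x)=\beta x-\lfloor\beta x\rfloor$, and let $T_\beta^n$ denote the $n$-th iterate of $T_\beta$. Let $v_\beta(x)\in[0,+\infty]$ be the supremum of the real numbers $v$ for which the inequality $T_\beta^n x<(\beta^n)^{-v}$ has infinitely many solutions in positive integers $n$. Let $\hat v_\beta(x)\in[0,+\infty]$ be the supremum of the real numbers $w$ such that, for every sufficiently large integer $N$, the inequality $T_\beta^n x<(\beta^N)^{-w}$ has a solution $n$ with $1\le n\le N$. Let $\dim$ denote the Hausdorff dimension. **Theorem.** Let $\theta$ and $\hat v$ be positive real numbers with $\hat v<1$. If $\theta<1/(1-\hat v)$, then the set $$\{\beta>1:\hat v_\beta(1)\ge\hat v\}\cap\{\beta>1:v_\beta(1)=\theta\hat v\}$$ is empty. If $\theta\ge 1/(1-\hat v)$, then $$\dim\bigl(\{\beta>1:\hat v_\beta(1)=\hat v\}\cap\{\beta>1:v_\beta(1)=\theta\hat v\}\bigr)=\frac{\theta-1-\theta\hat v}{(1+\theta\hat v)(\theta-1)}.$$ Furthermore, $$\dim\{\beta>1:\hat v_\beta(1)\ge\hat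 v\}=\Bigl(\frac{1-\hat v}{1+\hat v}\Bigr)^2 \qquad\text{and}\qquad \dim\{\beta>1:\hat v_\beta(1)=1\}=0.$$ -/

import Mathlib

/-- The `β`-transformation `T_β x = β x - ⌊β x⌋`. -/
noncomputable def betaTransformation (β : ℝ) (x : ℝ) : ℝ :=
  β * x - (⌊β * x⌋ : ℝ)

/-- The exponent `v_β(x)`: the supremum, in the extended reals, of the real numbers `v` for which
`T_β^n x < (β^n)^(-v)` has infinitely many solutions in positive integers `n`. -/
noncomputable def asymptoticExponent (β : ℝ) (x : ℝ) : EReal :=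
  sSup ((fun v : ℝ => (v : EReal)) ''
    {v : ℝ | {n : ℕ | 1 ≤ n ∧ (betaTransformation β)^[n] x < (β ^ n) ^ (-v)}.Infinite})

/-- The exponent `v̂_β(x)`: the supremum, in the extended reals, of the real numbers `v` such that,
for every sufficiently large integer `N`, the inequality `T_β^n x < (β^N)^(-v)` has a solution `n`
with `1 ≤ n ≤ N`. -/
noncomputable def uniformExponent (β : ℝ) (x : ℝ) : EReal :=
  sSup ((fun v : ℝ => (v : EReal)) ''
    {v : ℝ | ∀ᶠ N : ℕ in Filter.atTop,
      ∃ n : ℕ, 1 ≤ n ∧ n ≤ N ∧ (betaTransformation β)^[n] x < (β ^ N) ^ (-v)})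

open Filter Topology MeasureTheory Set
open scoped ENNReal NNReal

/-! A value $T_\beta^n 1\approx\beta^{-l}$ means a run of about $l$ zero digits from position $n$
on. So both exponents only see the long runs of zeros in the expansion of $1$, and the theorem
becomes a count of digit words.

Upper bounds. Let $v$ bound the uniform exponent from below and let $s$ be the asymptotic exponent.
Before a nonzero digit near position $n$ the uniform condition puts a run of about $vn$ zeros
(`exists_block_before`). It starts at some $p\ge(v/s)n$, since a run that starts at $p$ has length
at most about $sp$. As the run ends before $n$, this gives $v(1+s)\le s$, hence the empty case.
Repeated from $p$, the argument forces about $vn(1+v/s+(v/s)^2+\dots)=nvs/(s-v)$ zeros before $n$,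
which leaves about $\beta^{n(1-vs/(s-v))}$ words (`cov_chain`). For infinitely many such $n$ a run
of about $sn$ zeros follows, so the parameters that share a word lie in an interval of length about
$\beta^{-(1+s)n}$. The quotient of the exponents bounds the dimension near $(s,\beta)$, and
`dimH_le_of_local` passes to the whole set. Its maximum over $s$ is controlled by
`dimension_formula_le`.

Lower bounds. With $u=\theta v$, put zeros exactly at the positions in $(\theta^k,(1+u)\theta^k]$
for large $k$, the digit $q+2$ at the start and arbitrary digits from $1$ to $q$ elsewhere. The
large first digit makes each such sequence the expansion of $1$ in some base in $[q+2,q+3]$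
(`exists_base`). The free positions have lower density equal to the claimed dimension, and their
digits encode a point of $[0,1)$. The map from the base to this point is Hölder
(`le_dimH_of_digits`); letting $q\to\infty$ removes the loss $\log q/\log(q+3)$. -/

/-! ### Digits, orbit of $1$ and length of parameter cylinders. -/

/-- The orbit of `1` under the `β`-transformation. -/
noncomputable def orb (β : ℝ) (n : ℕ) : ℝ := (betaTransformation β)^[n] 1

/-- The digits of the `β`-expansion of `1`, indexed from `0`. -/
noncomputable def dig (β : ℝ) (n : ℕ) : ℤ := ⌊β * orb β n⌋

lemma orb_zero (β : ℝ) : orb β 0 = 1 := rfl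

lemma orb_succ (β : ℝ) (n : ℕ) : orb β (n + 1) = β * orb β n - dig β n := by
  simp only [orb, dig, Function.iterate_succ_apply', betaTransformation]

lemma orb_succ_nonneg (β : ℝ) (n : ℕ) : 0 ≤ orb β (n + 1) := by
  rw [orb_succ]; exact sub_nonneg.2 (Int.floor_le _)

lemma orb_succ_lt_one (β : ℝ) (n : ℕ) : orb β (n + 1) < 1 := by
  rw [orb_succ]; have := Int.lt_floor_add_one (β * orb β n); simp only [dig]; linarith

lemma orb_nonneg (β : ℝ) (n : ℕ) : 0 ≤ orb β n := by
  cases n with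
  | zero => simp [orb_zero]
  | succ n => exact orb_succ_nonneg β n

lemma orb_le_one (β : ℝ) (n : ℕ) : orb β n ≤ 1 := by
  cases n with
  | zero => simp [orb_zero]
  | succ n => exact (orb_succ_lt_one β n).le

lemma dig_nonneg {β : ℝ} (hβ : 0 ≤ β) (n : ℕ) : 0 ≤ dig β n :=
  Int.floor_nonneg.2 (mul_nonneg hβ (orb_nonneg β n))

lemma dig_zero_ne {β : ℝ} (hβ : 1 < β) : dig β 0 ≠ 0 := by
  have : (1 : ℤ) ≤ dig β 0 := by
    simp only [dig, orb_zero, Int.le_floor]; push_cast; linarith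
  omega

/-- A small point of the orbit is followed by a block of zeros. -/
lemma orb_add_of_lt {β : ℝ} (hβ : 1 < β) {n l : ℕ} (h : orb β n * β ^ l < 1) :
    ∀ j ≤ l, orb β (n + j) = orb β n * β ^ j := by
  intro j hj
  induction j with
  | zero => simp
  | succ j ih =>
    have ih := ih (by omega)
    have hlt : β * orb β (n + j) < 1 := by
      rw [ih]
      calc β * (orb β n * β ^ j) = orb β n * β ^ (j + 1) := by ring
        _ ≤ orb β n * β ^ l := by
          gcongr
          · exact orb_nonneg β n
          · exact hβ.le
        _ < 1 := h
    have : dig β (n + j) = 0 := by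
      simp only [dig, Int.floor_eq_zero_iff]
      exact ⟨mul_nonneg (by linarith) (orb_nonneg _ _), hlt⟩
    rw [← add_assoc, orb_succ, this, ih]; push_cast; ring

lemma dig_eq_zero_of_lt {β : ℝ} (hβ : 1 < β) {n l : ℕ} (h : orb β n * β ^ l < 1) {i : ℕ}
    (hi : n ≤ i) (hi' : i < n + l) : dig β i = 0 := by
  obtain ⟨j, rfl⟩ := Nat.exists_eq_add_of_le hi
  have h1 := orb_add_of_lt hβ h j (by omega)
  have h2 := orb_add_of_lt hβ h (j + 1) (by omega)
  rw [← add_assoc, orb_succ, h1] at h2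
  have : (dig β (n + j) : ℝ) = 0 := by rw [pow_succ] at h2; linarith
  exact_mod_cast this

/-- Every point of the orbit lies above a point that is preceded by a nonzero digit. -/
lemma exists_le_dig_ne_zero {β : ℝ} (hβ : 1 < β) (n : ℕ) (hn : 1 ≤ n) :
    ∃ p, 1 ≤ p ∧ p ≤ n ∧ dig β (p - 1) ≠ 0 ∧ orb β p ≤ orb β n := by
  induction n, hn using Nat.le_induction with
  | base => exact ⟨1, le_rfl, le_rfl, dig_zero_ne hβ, le_rfl⟩
  | succ n hn ih =>
    by_cases h : dig β n = 0
    · obtain ⟨p, h1, h2, h3, h4⟩ := ih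
      refine ⟨p, h1, by omega, h3, h4.trans ?_⟩
      rw [orb_succ, h]; push_cast; nlinarith [orb_nonneg β n]
    · exact ⟨n + 1, by omega, le_rfl, h, le_rfl⟩

lemma exists_pos_le_orb {β : ℝ} (h : ∀ n, 0 < orb β n) (X : ℕ) :
    ∃ ε > 0, ∀ n < X, ε ≤ orb β n := by
  induction X with
  | zero => exact ⟨1, one_pos, by simp⟩
  | succ X ih =>
    obtain ⟨ε, h1, h2⟩ := ih
    refine ⟨min ε (orb β X), lt_min h1 (h X), fun n hn => ?_⟩
    rcases Nat.lt_succ_iff_lt_or_eq.1 hn with h' | rfl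
    · exact (min_le_left _ _).trans (h2 n h')
    · exact min_le_right _ _

/-- While the digits agree, each step multiplies the gap between the two orbits by at least $\beta$;
the first step creates the gap $\beta'-\beta$. -/
lemma sub_mul_pow_le {β β' : ℝ} (hβ : 1 < β) (h : β ≤ β') (n : ℕ)
    (hd : ∀ i < n + 1, dig β i = dig β' i) :
    (β' - β) * β ^ n ≤ orb β' (n + 1) - orb β (n + 1) := by
  induction n with
  | zero => simp [orb_succ, orb_zero, hd 0]
  | succ n ih =>
    have ih := ih fun i hi => hd i (by omega)
    rw [orb_succ β (n + 1), orb_succ β' (n + 1), hd (n + 1) (by omega), pow_succ]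
    nlinarith [mul_nonneg (sub_nonneg.2 h) (orb_nonneg β' (n + 1))]

lemma abs_sub_le_of_dig_eq {a β β' : ℝ} (ha : 1 < a) (hβ : a ≤ β) (hβ' : a ≤ β') (n : ℕ)
    (hd : ∀ i < n + 1, dig β i = dig β' i) : |β - β'| ≤ (a ^ n)⁻¹ := by
  wlog h : β ≤ β' generalizing β β'
  · rw [abs_sub_comm]
    exact this hβ' hβ (fun i hi => (hd i hi).symm) (le_of_not_ge h)
  rw [abs_sub_comm, abs_of_nonneg (sub_nonneg.2 h), ← one_div, le_div_iff₀ (by positivity)]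
  have h1 := sub_mul_pow_le (ha.trans_le hβ) h n hd
  have h2 : (β' - β) * a ^ n ≤ (β' - β) * β ^ n :=
    mul_le_mul_of_nonneg_left (pow_le_pow_left₀ (by linarith) hβ n) (sub_nonneg.2 h)
  linarith [orb_nonneg β (n + 1), orb_le_one β' (n + 1)]

/-! ### Counting digit words. -/

/-- The first `n` digits of the parameters in `S` take at most `K` values. -/
def Cov (n : ℕ) (K : ℝ) (S : Set ℝ) : Prop :=
  ∃ k : ℕ, (k : ℝ) ≤ K ∧ ∃ f : ℝ → ℕ, (∀ β ∈ S, f β < k) ∧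
    ∀ β ∈ S, ∀ β' ∈ S, f β = f β' → ∀ i < n, dig β i = dig β' i

lemma Cov.mono {n : ℕ} {K K' : ℝ} {S S' : Set ℝ} (h : Cov n K S) (hK : K ≤ K') (hS : S' ⊆ S) :
    Cov n K' S' := by
  obtain ⟨k, hk, f, h1, h2⟩ := h
  exact ⟨k, hk.trans hK, f, fun β hβ => h1 β (hS hβ),
    fun β hβ β' hβ' => h2 β (hS hβ) β' (hS hβ')⟩

lemma cov_zero (S : Set ℝ) : Cov 0 1 S :=
  ⟨1, by simp, fun _ => 0, by simp, by simp⟩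

/-- Forced zeros lengthen the words at no cost. This is the source of every gain in dimension. -/
lemma Cov.zeros {n m : ℕ} {K : ℝ} {S : Set ℝ} (h : Cov n K S)
    (hz : ∀ β ∈ S, ∀ i, n ≤ i → i < m → dig β i = 0) : Cov m K S := by
  obtain ⟨k, hk, f, h1, h2⟩ := h
  refine ⟨k, hk, f, h1, fun β hβ β' hβ' he i hi => ?_⟩
  rcases lt_or_ge i n with h' | h'
  · exact h2 β hβ β' hβ' he i h'
  · rw [hz β hβ i h' hi, hz β' hβ' i h' hi]

lemma Cov.iUnion {n N : ℕ} {K : ℝ} {S : Set ℝ} {T : ℕ → Set ℝ} (h : ∀ i < N, Cov n K (T i))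
    (hS : ∀ β ∈ S, ∃ i < N, β ∈ T i) : Cov n (N * K) S := by
  rcases Nat.eq_zero_or_pos N with rfl | hN
  · refine ⟨0, by simp, fun _ => 0, fun β hβ => ?_, fun β hβ => ?_⟩ <;>
    · obtain ⟨i, hi, -⟩ := hS β hβ
      omega
  choose! k hk f h1 h2 using h
  obtain ⟨i₀, hi₀, hmax⟩ := Finset.exists_max_image (Finset.range N) k ⟨0, by simpa using hN⟩
  simp only [Finset.mem_range] at hi₀ hmax
  choose! j hj hjT using hS
  refine ⟨N * k i₀, ?_, fun β => f (j β) β + k i₀ * j β, fun β hβ => ?_,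
    fun β hβ β' hβ' he => ?_⟩
  · push_cast
    exact mul_le_mul_of_nonneg_left (hk i₀ hi₀) (Nat.cast_nonneg _)
  · have := (h1 (j β) (hj β hβ) β (hjT β hβ)).trans_le (hmax _ (hj β hβ))
    calc f (j β) β + k i₀ * j β < k i₀ + k i₀ * j β := by omega
      _ = (j β + 1) * k i₀ := by ring
      _ ≤ N * k i₀ := Nat.mul_le_mul_right _ (hj β hβ)
  · have l1 := (h1 (j β) (hj β hβ) β (hjT β hβ)).trans_le (hmax _ (hj β hβ))
    have l2 := (h1 (j β') (hj β' hβ') β' (hjT β' hβ')).trans_le (hmax _ (hj β' hβ'))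
    have e1 : j β = j β' := by
      have := congrArg (· / k i₀) he
      simpa [Nat.add_mul_div_left _ _ (Nat.zero_lt_of_lt l1), Nat.div_eq_of_lt l1,
        Nat.div_eq_of_lt l2] using this
    simp only [e1] at he
    have hjT' := hjT β hβ
    rw [e1] at hjT'
    exact h2 (j β') (hj β' hβ') β hjT' β' (hjT β' hβ') (by omega)

/-- The value in base `B` of the block of `L` digits that starts at `n`. -/
noncomputable def blockValue (B β : ℝ) : ℕ → ℕ → ℝ
  | _, 0 => 0
  | n, L + 1 => (dig β n + blockValue B β (n + 1) L) / B

lemma blockValue_nonneg {B β : ℝ} (hβ : 0 ≤ β) (hB : 0 ≤ B) (n L : ℕ) :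
    0 ≤ blockValue B β n L := by
  induction L generalizing n with
  | zero => simp [blockValue]
  | succ L ih =>
    have : (0 : ℝ) ≤ dig β n := by exact_mod_cast dig_nonneg hβ n
    have := ih (n + 1)
    simp only [blockValue]; positivity

/-- The factor $b/B<1$ is the point of evaluating in a base $B$ above all parameters: tails stay
away from $1$, so distinct words get separated values. -/
lemma blockValue_le {b B β : ℝ} (hβ : 0 < β) (hb : β ≤ b) (hB : b ≤ B) (n L : ℕ) :
    blockValue B β n L ≤ b / B * orb β n := by
  have hB0 : 0 < B := by linarith
  induction L generalizing n with
  | zero => simp only [blockValue]; have := orb_nonneg β n; have : 0 ≤ b := by linarith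
            positivity
  | succ L ih =>
    have ih := ih (n + 1)
    have h1 : b / B * orb β (n + 1) ≤ 1 * orb β (n + 1) :=
      mul_le_mul_of_nonneg_right ((div_le_one hB0).2 hB) (orb_nonneg _ _)
    rw [orb_succ] at h1
    rw [orb_succ] at ih
    simp only [blockValue]
    rw [div_mul_eq_mul_div]
    refine div_le_div_of_nonneg_right ?_ hB0.le
    nlinarith [mul_le_mul_of_nonneg_right hb (orb_nonneg β n)]

lemma dig_eq_of_blockValue {b B β β' : ℝ} (hβ : 0 < β) (hb : β ≤ b) (hβ' : 0 < β') (hb' : β' ≤ b)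
    (hB : b < B) (hB1 : 1 ≤ B) {n n' L : ℕ}
    (h : |blockValue B β n L - blockValue B β' n' L| < (1 - b / B) * (B ^ L)⁻¹) :
    ∀ i < L, dig β (n + i) = dig β' (n' + i) := by
  have hB0 : 0 < B := by linarith
  have hr : 0 < 1 - b / B := by rw [sub_pos, div_lt_one hB0]; exact hB
  induction L generalizing n n' with
  | zero => simp
  | succ L ih =>
    simp only [blockValue] at h
    rw [← sub_div, abs_div, abs_of_pos hB0, div_lt_iff₀ hB0, pow_succ, mul_inv, mul_assoc, mul_assoc,
      inv_mul_cancel₀ hB0.ne', mul_one] at h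
    have e : dig β n = dig β' n' := by
      by_contra hne
      have h1 : (1 : ℝ) ≤ |(dig β n : ℝ) - dig β' n'| := by
        exact_mod_cast Int.one_le_abs (sub_ne_zero.2 hne)
      have hbB : 0 ≤ b / B := by have : 0 ≤ b := by linarith
                                 positivity
      have k1 := (blockValue_le hβ hb hB.le (n + 1) L).trans
        (mul_le_of_le_one_right hbB (orb_le_one _ _))
      have k2 := (blockValue_le hβ' hb' hB.le (n' + 1) L).trans
        (mul_le_of_le_one_right hbB (orb_le_one _ _))
      have k3 := blockValue_nonneg hβ.le hB0.le (n + 1) L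
      have k4 := blockValue_nonneg hβ'.le hB0.le (n' + 1) L
      have h2 : (1 - b / B) * (B ^ L)⁻¹ ≤ 1 - b / B :=
        mul_le_of_le_one_right hr.le (inv_le_one_of_one_le₀ (one_le_pow₀ hB1))
      rcases le_abs.1 h1 with h1 | h1 <;> linarith [abs_lt.1 h]
    rintro (_ | i) hi
    · simpa using e
    · have := ih (n := n + 1) (n' := n' + 1) (by rw [e] at h; simpa using h) i (by omega)
      simpa [add_assoc, add_comm 1 i] using this

/-- Block values lie in $[0,1]$ and distinct blocks are $(1-b/B)B^{-L}$ apart, so $O(B^L)$ cells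
suffice, uniformly in the starting position and in $\beta\le b$. This replaces the count of
admissible words in a single base. -/
lemma Cov.extend {b B : ℝ} (hB : b < B) (hB1 : 1 ≤ B) {n : ℕ} {K : ℝ} {S : Set ℝ}
    (hS : ∀ β ∈ S, 0 < β ∧ β ≤ b) (h : Cov n K S) (L : ℕ) :
    Cov (n + L) (K * ((1 / (1 - b / B) + 1) * B ^ L)) S := by
  have hB0 : 0 < B := by linarith
  have hr : 0 < 1 - b / B := by rw [sub_pos, div_lt_one hB0]; exact hB
  obtain ⟨k, hk, f, h1, h2⟩ := h
  -- The inverse of the separation in `dig_eq_of_blockValue`; equal floors of the scaled values then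
  -- force equal blocks.
  set c : ℝ := B ^ L / (1 - b / B) with hc
  have hc0 : 0 < c := by positivity
  set g : ℝ → ℕ := fun β => ⌊blockValue B β n L * c⌋₊ with hg
  set m : ℕ := ⌊c⌋₊ + 1 with hm
  have hg1 : ∀ β ∈ S, g β < m := fun β hβ => by
    have := (blockValue_le (hS β hβ).1 (hS β hβ).2 hB.le n L).trans
        (mul_le_mul_of_nonneg_right (sub_pos.1 hr).le (orb_nonneg _ _))
    rw [hm, Nat.lt_succ_iff]
    refine Nat.floor_le_floor (mul_le_of_le_one_left hc0.le ?_)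
    linarith [orb_le_one β n]
  have hg2 : ∀ β ∈ S, ∀ β' ∈ S, g β = g β' → ∀ i < L, dig β (n + i) = dig β' (n + i) := by
    intro β hβ β' hβ' he
    refine dig_eq_of_blockValue (hS β hβ).1 (hS β hβ).2 (hS β' hβ').1 (hS β' hβ').2 hB hB1 ?_
    have n1 := mul_nonneg (blockValue_nonneg (hS β hβ).1.le hB0.le n L) hc0.le
    have n2 := mul_nonneg (blockValue_nonneg (hS β' hβ').1.le hB0.le n L) hc0.le
    have a1 := Nat.floor_le n1
    have a2 := Nat.lt_floor_add_one (blockValue B β n L * c)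
    have a3 := Nat.floor_le n2
    have a4 := Nat.lt_floor_add_one (blockValue B β' n L * c)
    simp only [hg] at he
    rw [he] at a1 a2
    have : |blockValue B β n L - blockValue B β' n L| * c < 1 := by
      have e : |blockValue B β n L - blockValue B β' n L| * c =
          |blockValue B β n L * c - blockValue B β' n L * c| := by
        rw [← sub_mul, abs_mul, abs_of_pos hc0]
      rw [e, abs_lt]
      constructor <;> linarith
    calc _ < 1 / c := (lt_div_iff₀ hc0).2 this
      _ = _ := by rw [hc, one_div_div, div_eq_mul_inv]
  have hk0 : (0 : ℝ) ≤ K := (Nat.cast_nonneg k).trans hk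
  refine ⟨k * m, ?_, fun β => f β * m + g β, fun β hβ => ?_, fun β hβ β' hβ' he i hi => ?_⟩
  · push_cast
    refine mul_le_mul hk ?_ (by positivity) hk0
    have := Nat.floor_le hc0.le
    have h3 : (1 : ℝ) ≤ B ^ L := one_le_pow₀ hB1
    calc (m : ℝ) ≤ c + 1 := by rw [hm]; push_cast; linarith
      _ ≤ c + B ^ L := by linarith
      _ = _ := by rw [hc]; ring
  · calc f β * m + g β < f β * m + m := by have := hg1 β hβ; omega
      _ = (f β + 1) * m := by ring
      _ ≤ k * m := Nat.mul_le_mul_right _ (h1 β hβ)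
  · have l1 := hg1 β hβ
    have l2 := hg1 β' hβ'
    have e1 : f β = f β' := by
      have := congrArg (· / m) he
      simpa [mul_comm _ m, Nat.mul_add_div (Nat.zero_lt_of_lt l1), Nat.div_eq_of_lt l1,
        Nat.div_eq_of_lt l2] using this
    have e2 : g β = g β' := by simp only [e1] at he; omega
    rcases lt_or_ge i n with h' | h'
    · exact h2 β hβ β' hβ' e1 i h'
    · obtain ⟨j, rfl⟩ := Nat.exists_eq_add_of_le h'
      exact hg2 β hβ β' hβ' e2 j (by omega)

/-! ### Counting words with nested blocks of zeros. -/

/-- Parameters in `S` whose first `n` digits contain `j` nested blocks of zeros. -/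
def chain (v ρ : ℝ) (S : Set ℝ) : ℕ → ℕ → Set ℝ
  | 0, _ => S
  | j + 1, n => {β | ∃ n' < n, ρ * (n - 1 : ℝ) ≤ n' ∧ n' + ⌊v * (n - 1 : ℝ)⌋₊ ≤ n ∧
      (∀ i, n' ≤ i → i < n' + ⌊v * (n - 1 : ℝ)⌋₊ → dig β i = 0) ∧ β ∈ chain v ρ S j n'}

lemma chain_subset (v ρ : ℝ) (S : Set ℝ) (j n : ℕ) : chain v ρ S j n ⊆ S := by
  induction j generalizing n with
  | zero => exact subset_rfl
  | succ j ih =>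
    rintro β ⟨n', -, -, -, -, h⟩
    exact ih n' h

lemma cov_empty (n : ℕ) {K : ℝ} (hK : 0 ≤ K) : Cov n K ∅ :=
  ⟨0, by simpa using hK, fun _ => 0, by simp, by simp⟩

/-- The saved proportion obeys $\lambda_{j+1}=v+\rho\lambda_j$: a proportion $v$ from the last
block, and $\lambda_j$ of a prefix of length about $\rho n$ or more. The choice of each prefix
length costs only a factor $n$. -/
lemma cov_chain {b B v ρ : ℝ} {S : Set ℝ} (hB : b < B) (hB1 : 1 ≤ B)
    (hS : ∀ β ∈ S, 0 < β ∧ β ≤ b) (hv : 0 ≤ v) (hρ : 0 ≤ ρ) (j : ℕ) :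
    ∃ C : ℝ, 0 ≤ C ∧ ∀ n : ℕ,
      Cov n (C * (n + 1 : ℝ) ^ j * B ^ ((1 - v * ∑ i ∈ Finset.range j, ρ ^ i) * n))
        (chain v ρ S j n) := by
  have hB0 : 0 < B := by linarith
  have hr : 0 < 1 - b / B := by rw [sub_pos, div_lt_one hB0]; exact hB
  set A : ℝ := 1 / (1 - b / B) + 1 with hA
  have hA0 : 0 < A := by positivity
  induction j with
  | zero =>
    refine ⟨A, hA0.le, fun n => ?_⟩
    have := (cov_zero S).extend hB hB1 hS n
    refine (by simpa only [zero_add, one_mul] using this : Cov n (A * B ^ n) S).mono ?_ subset_rfl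
    simp
  | succ j ih =>
    obtain ⟨C, hC, ih⟩ := ih
    set lam : ℝ := v * ∑ i ∈ Finset.range j, ρ ^ i with hlam
    have hlam0 : 0 ≤ lam := mul_nonneg hv (Finset.sum_nonneg fun i _ => pow_nonneg hρ i)
    have hlam1 : v * ∑ i ∈ Finset.range (j + 1), ρ ^ i = v + ρ * lam := by
      rw [geom_sum_succ, hlam]; ring
    rw [hlam1]
    -- Absorbs the floor in the block length and the use of $n-1$ in place of $n$.
    set c : ℝ := v + 1 + lam * ρ with hc
    refine ⟨C * A * B ^ c, by positivity, fun n => ?_⟩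
    set l : ℕ := ⌊v * (n - 1 : ℝ)⌋₊ with hl
    set T : ℕ → Set ℝ := fun n' => {β | ρ * (n - 1 : ℝ) ≤ n' ∧ n' + l ≤ n ∧
      (∀ i, n' ≤ i → i < n' + l → dig β i = 0) ∧ β ∈ chain v ρ S j n'} with hT
    have key : ∀ n' < n, Cov n (C * (n + 1 : ℝ) ^ j * A *
        B ^ ((1 - (v + ρ * lam)) * n + c)) (T n') := by
      intro n' hn'
      by_cases h1 : ρ * (n - 1 : ℝ) ≤ n' ∧ n' + l ≤ n
      swap
      · have : T n' = ∅ := by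
          ext β; exact iff_of_false (fun h => h1 ⟨h.1, h.2.1⟩) id
        rw [this]; exact cov_empty _ (by positivity)
      obtain ⟨h1, h2⟩ := h1
      have hsub : T n' ⊆ chain v ρ S j n' := fun β h => h.2.2.2
      have k1 := ((ih n').mono le_rfl hsub).zeros (m := n' + l) fun β h i hi hi' =>
        h.2.2.1 i hi hi'
      have k2 := k1.extend hB hB1 (fun β h => hS β (chain_subset _ _ _ _ _ (hsub h)))
        (n - (n' + l))
      rw [Nat.add_sub_cancel' h2] at k2
      refine k2.mono ?_ subset_rfl
      have hn'n : (n' : ℝ) ≤ n := by exact_mod_cast hn'.le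
      have e1 : B ^ ((1 - lam) * n') * B ^ (n - (n' + l)) ≤
          B ^ ((1 - (v + ρ * lam)) * n + c) := by
        rw [← Real.rpow_natCast, ← Real.rpow_add hB0]
        refine Real.rpow_le_rpow_of_exponent_le hB1 ?_
        rw [Nat.cast_sub h2]; push_cast
        have := Nat.lt_floor_add_one (v * (n - 1 : ℝ))
        rw [← hl] at this
        have := mul_le_mul_of_nonneg_left h1 hlam0
        rw [hc]; nlinarith
      calc C * (n' + 1 : ℝ) ^ j * B ^ ((1 - lam) * n') * (A * B ^ (n - (n' + l)))
          = C * (n' + 1 : ℝ) ^ j * A * (B ^ ((1 - lam) * n') * B ^ (n - (n' + l))) := by ring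
        _ ≤ _ := by gcongr
    refine (Cov.iUnion (S := chain v ρ S (j + 1) n) key ?_).mono ?_ subset_rfl
    · rintro β ⟨n', h1, h2, h3, h4, h5⟩
      exact ⟨n', h1, h2, h3, h4, h5⟩
    · rw [Real.rpow_add hB0]
      calc (n : ℝ) * (C * (n + 1 : ℝ) ^ j * A * (B ^ ((1 - (v + ρ * lam)) * n) * B ^ c))
          ≤ (n + 1 : ℝ) * (C * (n + 1 : ℝ) ^ j * A *
              (B ^ ((1 - (v + ρ * lam)) * n) * B ^ c)) := by
            gcongr; linarith
        _ = _ := by ring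

/-! ### From coverings to Hausdorff dimension. -/

/-- A limsup set covered by a summable family of cylinders has small dimension. -/
lemma dimH_le_of_cov {a : ℝ} (ha : 1 < a) {D : ℝ≥0} {E : Set ℝ} {U : ℕ → Set ℝ}
    {l : ℕ → ℕ} {K : ℕ → ℝ} (hU : ∀ n, Cov (n + l n) (K n) (U n))
    (hUa : ∀ n, ∀ β ∈ U n, a ≤ β) (hE : ∀ β ∈ E, ∃ᶠ n in atTop, β ∈ U n)
    (hsum : Summable fun n => K n * (a * (a ^ (n + l n))⁻¹) ^ (D : ℝ)) : dimH E ≤ D := by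
  choose k hk f h1 h2 using hU
  have ha0 : 0 < a := by linarith
  let ι : ℕ → Type := fun H => Σ n : {n : ℕ // H + 1 ≤ n}, Fin (k n)
  let t : (H : ℕ) → ι H → Set ℝ := fun H i => {β ∈ U i.1 | f i.1 β = i.2}
  -- Agreement of $m$ digits bounds the distance by $a^{-(m-1)}$, hence the extra factor $a$. The
  -- condition $n\ge H+1$ in `ι` keeps $m\ge1$ and makes the diameters tend to zero.
  let r : ℕ → ℝ≥0∞ := fun H => ENNReal.ofReal (a * (a ^ H)⁻¹)
  have hd : ∀ n, 1 ≤ n → ∀ i, Metric.ediam {β ∈ U n | f n β = i} ≤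
      ENNReal.ofReal (a * (a ^ (n + l n))⁻¹) := by
    intro n hn i
    refine Metric.ediam_le fun β hβ β' hβ' => ?_
    rw [edist_dist, Real.dist_eq]
    refine ENNReal.ofReal_le_ofReal ?_
    obtain ⟨m, hm⟩ : ∃ m, n + l n = m + 1 := ⟨n + l n - 1, by omega⟩
    have := abs_sub_le_of_dig_eq ha (hUa n β hβ.1) (hUa n β' hβ'.1) m fun j hj =>
      h2 n β hβ.1 β' hβ'.1 (hβ.2.trans hβ'.2.symm) j (by omega)
    rw [hm, pow_succ, mul_inv, mul_left_comm, mul_inv_cancel₀ ha0.ne', mul_one]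
    exact this
  have hlim : Tendsto r atTop (𝓝 0) := by
    have : Tendsto (fun H : ℕ => a * (a ^ H)⁻¹) atTop (𝓝 (a * 0)) :=
      (tendsto_inv_atTop_zero.comp (tendsto_pow_atTop_atTop_of_one_lt ha)).const_mul a
    simpa [r] using ENNReal.tendsto_ofReal this
  have hmeas := Measure.hausdorffMeasure_le_liminf_tsum (ι := ι) (D : ℝ) E r hlim t
    (Eventually.of_forall fun H i => (hd i.1 (by have := i.1.2; omega) _).trans <|
      ENNReal.ofReal_le_ofReal <| mul_le_mul_of_nonneg_left
        (inv_anti₀ (by positivity) (pow_le_pow_right₀ ha.le (by have := i.1.2; omega))) ha0.le)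
    (Eventually.of_forall fun H β hβ => by
      obtain ⟨n, hn, hn'⟩ := (frequently_atTop.1 (hE β hβ)) (H + 1)
      exact mem_iUnion.2 ⟨⟨⟨n, hn⟩, ⟨f n β, h1 n β hn'⟩⟩, hn', rfl⟩)
  refine dimH_le_of_hausdorffMeasure_ne_top (ne_top_of_le_ne_top ?_ hmeas)
  have hS := hsum.tsum_ofReal_ne_top
  refine ne_top_of_le_ne_top hS (liminf_le_of_frequently_le' (Eventually.frequently ?_))
  refine Eventually.of_forall fun H => ?_
  calc ∑' i : ι H, Metric.ediam (t H i) ^ (D : ℝ)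
      = ∑' n : {n : ℕ // H + 1 ≤ n}, ∑' i : Fin (k n), Metric.ediam (t H ⟨n, i⟩) ^ (D : ℝ) :=
        ENNReal.tsum_sigma' (fun i : ι H => Metric.ediam (t H i) ^ (D : ℝ))
    _ ≤ ∑' n : {n : ℕ // H + 1 ≤ n},
          ENNReal.ofReal (K n * (a * (a ^ ((n : ℕ) + l n))⁻¹) ^ (D : ℝ)) := by
        refine ENNReal.tsum_le_tsum fun n => ?_
        rw [tsum_fintype]
        calc ∑ i : Fin (k n), Metric.ediam (t H ⟨n, i⟩) ^ (D : ℝ)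
            ≤ ∑ i : Fin (k n), ENNReal.ofReal ((a * (a ^ ((n : ℕ) + l n))⁻¹) ^ (D : ℝ)) := by
              refine Finset.sum_le_sum fun i _ => ?_
              refine (ENNReal.rpow_le_rpow (hd n (by have := n.2; omega) _) D.2).trans ?_
              exact (ENNReal.ofReal_rpow_of_nonneg (by positivity) D.2).le
          _ = ENNReal.ofReal (k n * (a * (a ^ ((n : ℕ) + l n))⁻¹) ^ (D : ℝ)) := by
              rw [Finset.sum_const, Finset.card_univ, Fintype.card_fin, nsmul_eq_mul,
                ENNReal.ofReal_mul (Nat.cast_nonneg _), ENNReal.ofReal_natCast]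
          _ ≤ _ := ENNReal.ofReal_le_ofReal
              (mul_le_mul_of_nonneg_right (hk n) (by positivity))
    _ ≤ _ := ENNReal.tsum_comp_le_tsum_of_injective Subtype.val_injective
          (fun n => ENNReal.ofReal (K n * (a * (a ^ (n + l n))⁻¹) ^ (D : ℝ)))

/-- The dimension of the parameters with `J` nested blocks of zeros before a long block of zeros,
at infinitely many places. -/
lemma dimH_le_of_chain {a b B v ρ s : ℝ} {D : ℝ≥0} {E : Set ℝ} {J : ℕ} (ha : 1 < a) (hB : b < B)
    (hB1 : 1 < B) (hv : 0 ≤ v) (hρ : 0 ≤ ρ)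
    (hE : ∀ β ∈ E, ∃ᶠ n : ℕ in atTop, β ∈ chain v ρ (Icc a b) J n ∧
      ∀ i, n ≤ i → i < n + ⌊s * n⌋₊ → dig β i = 0)
    (hD : (1 - v * ∑ i ∈ Finset.range J, ρ ^ i) * Real.log B < (1 + s) * D * Real.log a) :
    dimH E ≤ D := by
  obtain ⟨C, hC, hcov⟩ := cov_chain (S := Icc a b) hB hB1.le
    (fun β h => ⟨by linarith [h.1], h.2⟩) hv hρ J
  set κ : ℝ := 1 - v * ∑ i ∈ Finset.range J, ρ ^ i with hκ
  have ha0 : 0 < a := by linarith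
  have hB0 : 0 < B := by linarith
  -- The ratio of the dominating geometric series; `hD` says exactly that it is below $1$.
  set x : ℝ := B ^ κ * a ^ (-((1 + s) * D)) with hx
  have hx0 : 0 < x := by positivity
  have hx1 : x < 1 := by
    rw [hx, Real.rpow_def_of_pos hB0, Real.rpow_def_of_pos ha0, ← Real.exp_add, Real.exp_lt_one_iff]
    linarith
  have hU : ∀ n : ℕ, Cov (n + ⌊s * n⌋₊) (C * (n + 1 : ℝ) ^ J * B ^ (κ * n))
      {β | β ∈ chain v ρ (Icc a b) J n ∧ ∀ i, n ≤ i → i < n + ⌊s * n⌋₊ → dig β i = 0} := fun n =>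
    ((hcov n).mono le_rfl fun β h => h.1).zeros fun β h => h.2
  refine dimH_le_of_cov ha hU (fun n β h => (chain_subset _ _ _ _ _ h.1).1) hE ?_
  have hs1 : Summable fun n : ℕ => C * a ^ (2 * (D : ℝ)) * x⁻¹ *
      (((n + 1 : ℕ) : ℝ) ^ J * x ^ (n + 1)) := by
    refine Summable.mul_left _ ?_
    exact (summable_nat_add_iff (f := fun n : ℕ => (n : ℝ) ^ J * x ^ n) 1).2
      (summable_pow_mul_geometric_of_norm_lt_one J (by rwa [Real.norm_of_nonneg hx0.le]))
  refine Summable.of_nonneg_of_le (fun n => by positivity) (fun n => ?_) hs1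
  have e1 : (a * (a ^ (n + ⌊s * n⌋₊))⁻¹) ^ (D : ℝ) ≤
      a ^ (2 * (D : ℝ)) * (a ^ (-((1 + s) * D))) ^ n := by
    rw [← Real.rpow_natCast, ← Real.rpow_neg ha0.le, ← Real.rpow_natCast, ← Real.rpow_mul ha0.le,
      ← Real.rpow_add ha0]
    nth_rewrite 1 [← Real.rpow_one a]
    rw [← Real.rpow_add ha0, ← Real.rpow_mul ha0.le]
    refine Real.rpow_le_rpow_of_exponent_le ha.le ?_
    have := Nat.lt_floor_add_one (s * n)
    have hD0 : (0 : ℝ) ≤ D := D.2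
    push_cast
    nlinarith
  calc _ ≤ C * (n + 1 : ℝ) ^ J * B ^ (κ * n) *
        (a ^ (2 * (D : ℝ)) * (a ^ (-((1 + s) * D))) ^ n) := by gcongr
    _ = C * (n + 1 : ℝ) ^ J * (a ^ (2 * (D : ℝ)) * x ^ n) := by
      rw [Real.rpow_mul hB0.le, Real.rpow_natCast, hx, mul_pow]; ring
    _ = _ := by rw [pow_succ]; push_cast; field_simp

/-! ### The exponents read as blocks of zeros. -/

lemma lt_rpow_neg_iff {β : ℝ} (hβ : 1 < β) (x w : ℝ) (N : ℕ) :
    x < (β ^ N) ^ (-w) ↔ x * β ^ (w * N) < 1 := by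
  have hβ0 : 0 < β := by linarith
  rw [← Real.rpow_natCast_mul hβ0.le, mul_neg, Real.rpow_neg hβ0.le, ← one_div,
    lt_div_iff₀ (by positivity), mul_comm w]

lemma asymptoticExponent_eq {β : ℝ} (hβ : 1 < β) : asymptoticExponent β 1 =
    sSup ((fun v : ℝ => (v : EReal)) ''
      {w : ℝ | ∃ᶠ n : ℕ in atTop, 1 ≤ n ∧ orb β n * β ^ (w * n) < 1}) := by
  simp only [asymptoticExponent, lt_rpow_neg_iff hβ, Nat.frequently_atTop_iff_infinite, orb]

lemma uniformExponent_eq {β : ℝ} (hβ : 1 < β) : uniformExponent β 1 =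
    sSup ((fun v : ℝ => (v : EReal)) ''
      {w : ℝ | ∀ᶠ N : ℕ in atTop, ∃ n : ℕ, 1 ≤ n ∧ n ≤ N ∧ orb β n * β ^ (w * N) < 1}) := by
  simp only [uniformExponent, lt_rpow_neg_iff hβ, orb]

lemma orb_mul_rpow_le {β : ℝ} (hβ : 1 < β) {w w' : ℝ} (h : w ≤ w') (n N : ℕ) :
    orb β n * β ^ (w * N) ≤ orb β n * β ^ (w' * N) := by
  have := orb_nonneg β n
  gcongr
  exact hβ.le

lemma frequently_of_lt_asymptoticExponent {β s : ℝ} (hβ : 1 < β)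
    (h : (s : EReal) < asymptoticExponent β 1) :
    ∃ᶠ n : ℕ in atTop, 1 ≤ n ∧ orb β n * β ^ (s * n) < 1 := by
  rw [asymptoticExponent_eq hβ, lt_sSup_iff] at h
  obtain ⟨_, ⟨w, hw, rfl⟩, hsw⟩ := h
  exact Frequently.mono hw fun n hn =>
    ⟨hn.1, (orb_mul_rpow_le hβ (EReal.coe_lt_coe_iff.1 hsw).le n n).trans_lt hn.2⟩

lemma eventually_of_asymptoticExponent_lt {β s : ℝ} (hβ : 1 < β)
    (h : asymptoticExponent β 1 < s) : ∀ᶠ n : ℕ in atTop, 1 ≤ orb β n * β ^ (s * n) := by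
  rw [asymptoticExponent_eq hβ] at h
  have : ¬ ∃ᶠ n : ℕ in atTop, 1 ≤ n ∧ orb β n * β ^ (s * n) < 1 := fun hf =>
    h.not_ge (le_sSup ⟨s, hf, rfl⟩)
  rw [not_frequently] at this
  filter_upwards [this, eventually_ge_atTop 1] with n h1 h2
  by_contra h3
  exact h1 ⟨h2, not_le.1 h3⟩

lemma eventually_of_lt_uniformExponent {β v : ℝ} (hβ : 1 < β)
    (h : (v : EReal) < uniformExponent β 1) :
    ∀ᶠ N : ℕ in atTop, ∃ n : ℕ, 1 ≤ n ∧ n ≤ N ∧ orb β n * β ^ (v * N) < 1 := by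
  rw [uniformExponent_eq hβ, lt_sSup_iff] at h
  obtain ⟨_, ⟨w, hw, rfl⟩, hsw⟩ := h
  exact Eventually.mono hw fun N ⟨n, h1, h2, h3⟩ =>
    ⟨n, h1, h2, (orb_mul_rpow_le hβ (EReal.coe_lt_coe_iff.1 hsw).le n N).trans_lt h3⟩

/-- The point $0$ is fixed, so an orbit that reaches it violates every such lower bound. -/
lemma orb_pos_of_eventually {β s : ℝ} (h : ∀ᶠ n : ℕ in atTop, 1 ≤ orb β n * β ^ (s * n))
    (n : ℕ) : 0 < orb β n := by
  refine (orb_nonneg β n).lt_of_ne' fun h0 => ?_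
  have hz : ∀ j, orb β (n + j) = 0 := by
    intro j
    induction j with
    | zero => exact h0
    | succ j ih => rw [← add_assoc, orb_succ, dig, ih]; simp
  obtain ⟨N, hN⟩ := eventually_atTop.1 h
  have := hN (n + N) (by omega)
  rw [hz] at this
  norm_num at this

lemma dig_eq_zero_of_rpow_lt {β w : ℝ} (hβ : 1 < β) {n : ℕ} {x : ℝ} (hx : 0 ≤ w * x)
    (h : orb β n * β ^ (w * x) < 1) {i : ℕ} (hi : n ≤ i) (hi' : i < n + ⌊w * x⌋₊) :
    dig β i = 0 := by
  refine dig_eq_zero_of_lt hβ (lt_of_le_of_lt ?_ h) hi hi'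
  rw [← Real.rpow_natCast]
  exact mul_le_mul_of_nonneg_left (Real.rpow_le_rpow_of_exponent_le hβ.le (Nat.floor_le hx))
    (orb_nonneg β n)

lemma tendsto_rpow_mul_natCast {β w : ℝ} (hβ : 1 < β) (hw : 0 < w) :
    Tendsto (fun n : ℕ => β ^ (w * n)) atTop atTop := by
  have : (fun n : ℕ => β ^ (w * n)) = fun n : ℕ => (β ^ w) ^ n := by
    ext n; rw [Real.rpow_mul (by linarith), Real.rpow_natCast]
  rw [this]
  exact tendsto_pow_atTop_atTop_of_one_lt (Real.one_lt_rpow hβ hw)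

/-- A position after a nonzero digit has a long block of zeros not too far before it. -/
lemma exists_block_before {β v s : ℝ} (hβ : 1 < β) (hv : 0 < v) (hs : 0 < s)
    (h1 : ∀ᶠ N : ℕ in atTop, ∃ n : ℕ, 1 ≤ n ∧ n ≤ N ∧ orb β n * β ^ (v * N) < 1)
    (h2 : ∀ᶠ n : ℕ in atTop, 1 ≤ orb β n * β ^ (s * n)) :
    ∀ᶠ n : ℕ in atTop, dig β (n - 1) ≠ 0 → ∃ p < n, dig β (p - 1) ≠ 0 ∧
      v / s * (n - 1 : ℝ) ≤ p ∧ p + ⌊v * (n - 1 : ℝ)⌋₊ ≤ n ∧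
      ∀ i, p ≤ i → i < p + ⌊v * (n - 1 : ℝ)⌋₊ → dig β i = 0 := by
  obtain ⟨X, hX⟩ := eventually_atTop.1 h2
  obtain ⟨ε, hε, hεX⟩ := exists_pos_le_orb (orb_pos_of_eventually h2) X
  have h3 : ∀ᶠ N : ℕ in atTop, 1 / ε ≤ β ^ (v * N) :=
    (tendsto_rpow_mul_natCast hβ hv).eventually_ge_atTop _
  obtain ⟨Y, hY⟩ := eventually_atTop.1 (h1.and h3)
  filter_upwards [eventually_ge_atTop (Y + 1)] with n hn hd
  -- The uniform condition is used at $N=n-1$, the place of the nonzero digit: a block that starts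
  -- at or before $N$ must end before it.
  obtain ⟨N, rfl⟩ : ∃ N, n = N + 1 := ⟨n - 1, by omega⟩
  obtain ⟨⟨m, hm1, hmN, hm⟩, hN⟩ := hY N (by omega)
  obtain ⟨p, hp1, hpm, hpd, hp⟩ := exists_le_dig_ne_zero hβ m hm1
  have hβ0 : 0 < β := by linarith
  have hpN : orb β p * β ^ (v * N) < 1 :=
    (mul_le_mul_of_nonneg_right hp (by positivity)).trans_lt hm
  -- Moving back to a nonzero digit could land among the first $X$ points, but those are bounded
  -- below by $\varepsilon$.
  have hpX : X ≤ p := by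
    by_contra hlt
    have := hεX p (not_le.1 hlt)
    rw [div_le_iff₀ hε] at hN
    have := mul_le_mul_of_nonneg_right this (Real.rpow_nonneg hβ0.le (v * N))
    linarith
  have hps : v * N ≤ s * p := by
    have k := hX p hpX
    have : β ^ (v * N) < β ^ (s * p) :=
      lt_of_mul_lt_mul_left (hpN.trans_le k) (orb_nonneg β p)
    exact ((Real.rpow_lt_rpow_left_iff hβ).1 this).le
  have e : ((N + 1 : ℕ) : ℝ) - 1 = N := by push_cast; ring
  rw [e]
  have hz : ∀ i, p ≤ i → i < p + ⌊v * (N : ℝ)⌋₊ → dig β i = 0 := fun i hi hi' =>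
    dig_eq_zero_of_rpow_lt hβ (by positivity) hpN hi hi'
  refine ⟨p, by omega, hpd, ?_, ?_, hz⟩
  · rw [div_mul_eq_mul_div, div_le_iff₀ hs]; linarith
  · by_contra hlt
    exact hd (hz N (by omega) (by omega))

lemma eventually_mem_chain {β v s : ℝ} (hβ : 1 < β) (hv : 0 < v) (hs : 0 < s)
    (h1 : ∀ᶠ N : ℕ in atTop, ∃ n : ℕ, 1 ≤ n ∧ n ≤ N ∧ orb β n * β ^ (v * N) < 1)
    (h2 : ∀ᶠ n : ℕ in atTop, 1 ≤ orb β n * β ^ (s * n)) {S : Set ℝ} (hS : β ∈ S) (J : ℕ) :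
    ∀ᶠ n : ℕ in atTop, dig β (n - 1) ≠ 0 → β ∈ chain v (v / s) S J n := by
  induction J with
  | zero => exact Eventually.of_forall fun n _ => hS
  | succ J ih =>
    obtain ⟨X, hX⟩ := eventually_atTop.1 ih
    have hlim : Tendsto (fun n : ℕ => v / s * ((n : ℝ) - 1)) atTop atTop :=
      (tendsto_atTop_add_const_right _ (-1 : ℝ) tendsto_natCast_atTop_atTop).const_mul_atTop
        (by positivity)
    filter_upwards [exists_block_before hβ hv hs h1 h2, hlim.eventually_ge_atTop (X : ℝ)]
      with n hn hnX hd
    obtain ⟨p, hpn, hpd, hp, hpl, hz⟩ := hn hd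
    exact ⟨p, hpn, hp, hpl, hz, hX p (by exact_mod_cast hnX.trans hp) hpd⟩

/-- A small orbit point may sit inside a run of zeros. The start of the run is smaller still and has
a smaller index, so the inequality survives; positivity of the orbit keeps these starts unbounded.
-/
lemma frequently_dig_ne_zero {β s : ℝ} (hβ : 1 < β) (hs : 0 < s) (hpos : ∀ n, 0 < orb β n)
    (h : ∃ᶠ n : ℕ in atTop, 1 ≤ n ∧ orb β n * β ^ (s * n) < 1) :
    ∃ᶠ n : ℕ in atTop, dig β (n - 1) ≠ 0 ∧ orb β n * β ^ (s * n) < 1 := by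
  rw [frequently_atTop]
  intro X
  have hβ0 : 0 < β := by linarith
  obtain ⟨ε, hε, hεX⟩ := exists_pos_le_orb hpos X
  obtain ⟨n, ⟨hn1, hn⟩, hnε⟩ := (h.and_eventually
    ((tendsto_rpow_mul_natCast hβ hs).eventually_ge_atTop (1 / ε))).exists
  obtain ⟨p, hp1, hpn, hpd, hp⟩ := exists_le_dig_ne_zero hβ n hn1
  refine ⟨p, ?_, hpd, lt_of_le_of_lt (mul_le_mul hp ?_ (by positivity) (orb_nonneg _ _)) hn⟩
  · by_contra hlt
    rw [div_le_iff₀ hε] at hnε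
    have := mul_le_mul_of_nonneg_right ((hεX p (not_le.1 hlt)).trans hp)
      (Real.rpow_nonneg hβ0.le (s * n))
    linarith
  · refine Real.rpow_le_rpow_of_exponent_le hβ.le (mul_le_mul_of_nonneg_left ?_ hs.le)
    exact_mod_cast hpn

lemma frequently_mem_chain {β v s s' : ℝ} (hβ : 1 < β) (hv : 0 < v) (hs : 0 < s) (hs' : 0 < s')
    (h1 : (v : EReal) < uniformExponent β 1) (h2 : (s : EReal) < asymptoticExponent β 1)
    (h3 : asymptoticExponent β 1 < s') {S : Set ℝ} (hS : β ∈ S) (J : ℕ) :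
    ∃ᶠ n : ℕ in atTop, β ∈ chain v (v / s') S J n ∧
      ∀ i, n ≤ i → i < n + ⌊s * n⌋₊ → dig β i = 0 := by
  have h3 := eventually_of_asymptoticExponent_lt hβ h3
  refine ((frequently_dig_ne_zero hβ hs (orb_pos_of_eventually h3)
    (frequently_of_lt_asymptoticExponent hβ h2)).and_eventually
    (eventually_mem_chain hβ hv hs' (eventually_of_lt_uniformExponent hβ h1) h3 hS J)).mono ?_
  rintro n ⟨⟨hd, hn⟩, hc⟩
  exact ⟨hc hd, fun i hi hi' => dig_eq_zero_of_rpow_lt hβ (by positivity) hn hi hi'⟩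

lemma frequently_zeros {β s : ℝ} (hβ : 1 < β) (hs : 0 ≤ s)
    (h2 : (s : EReal) < asymptoticExponent β 1) :
    ∃ᶠ n : ℕ in atTop, ∀ i, n ≤ i → i < n + ⌊s * n⌋₊ → dig β i = 0 :=
  (frequently_of_lt_asymptoticExponent hβ h2).mono fun n hn i hi hi' =>
    dig_eq_zero_of_rpow_lt hβ (by positivity) hn.2 hi hi'

lemma asymptoticExponent_nonneg {β : ℝ} (hβ : 1 < β) : 0 ≤ asymptoticExponent β 1 := by
  refine le_of_forall_lt fun c hc => ?_
  obtain ⟨r, h1, h2⟩ := EReal.lt_iff_exists_real_btwn.1 hc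
  refine h1.trans_le ?_
  rw [asymptoticExponent_eq hβ]
  have hr : r < 0 := by exact_mod_cast h2
  refine le_sSup ⟨r, Eventually.frequently ?_, rfl⟩
  filter_upwards [eventually_ge_atTop 1] with n hn
  refine ⟨hn, ?_⟩
  obtain ⟨m, rfl⟩ : ∃ m, n = m + 1 := ⟨n - 1, by omega⟩
  have k1 := orb_succ_lt_one β m
  have k2 : β ^ (r * (m + 1 : ℕ)) ≤ 1 :=
    Real.rpow_le_one_of_one_le_of_nonpos hβ.le (mul_nonpos_of_nonpos_of_nonneg hr.le (by positivity))
  nlinarith [orb_nonneg β (m + 1)]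

/-- The relation between the two exponents of an infinite expansion. -/
lemma mul_one_add_le_of_exponents {β v s : ℝ} (hβ : 1 < β) (hv : 0 < v)
    (h1 : (v : EReal) ≤ uniformExponent β 1) (h2 : asymptoticExponent β 1 = s) :
    v * (1 + s) ≤ s := by
  have hs : 0 ≤ s := by
    have := asymptoticExponent_nonneg hβ
    rw [h2] at this; exact_mod_cast this
  have key : ∀ v' s', 0 < v' → v' < v → s < s' → v' * (1 + s') ≤ s' := by
    intro v' s' hv' hvv hss
    have hs' : 0 < s' := by linarith
    have e1 := eventually_of_lt_uniformExponent hβ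
      ((EReal.coe_lt_coe_iff.2 hvv).trans_le h1)
    have e2 := eventually_of_asymptoticExponent_lt (s := s') hβ
      (by rw [h2]; exact EReal.coe_lt_coe_iff.2 hss)
    have hf : ∃ᶠ n : ℕ in atTop, dig β (n - 1) ≠ 0 := by
      rw [frequently_atTop]
      intro X
      obtain ⟨ε, hε, hεX⟩ := exists_pos_le_orb (orb_pos_of_eventually e2) X
      obtain ⟨N, ⟨m, hm1, -, hm⟩, hN⟩ := (e1.and
        ((tendsto_rpow_mul_natCast hβ hv').eventually_ge_atTop (1 / ε))).exists
      obtain ⟨p, hp1, hpn, hpd, hp⟩ := exists_le_dig_ne_zero hβ m hm1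
      refine ⟨p, ?_, hpd⟩
      by_contra hlt
      rw [div_le_iff₀ hε] at hN
      have := mul_le_mul_of_nonneg_right ((hεX p (not_le.1 hlt)).trans hp)
        (Real.rpow_nonneg (by linarith : (0 : ℝ) ≤ β) (v' * N))
      linarith
    by_contra hlt
    push Not at hlt
    -- The block before $n$ occupies a proportion $v'$ and starts at proportion at least $v'/s'$; a
    -- sum above $1$ leaves no room for it.
    have hc : 0 < v' / s' + v' - 1 := by
      have : v' / s' + v' - 1 = (v' * (1 + s') - s') / s' := by field_simp
      rw [this]; exact div_pos (by linarith) hs'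
    have hlim : Tendsto (fun n : ℕ => (v' / s' + v' - 1) * ((n : ℝ) - 1)) atTop atTop :=
      (tendsto_atTop_add_const_right _ (-1 : ℝ) tendsto_natCast_atTop_atTop).const_mul_atTop hc
    obtain ⟨n, ⟨hd, hn⟩, hn2⟩ := ((hf.and_eventually
      (exists_block_before hβ hv' hs' e1 e2)).and_eventually
      (hlim.eventually_gt_atTop 2)).exists
    obtain ⟨p, hpn, -, hp, hpl, -⟩ := hn hd
    have k1 : (p : ℝ) + ⌊v' * (n - 1 : ℝ)⌋₊ ≤ n := by exact_mod_cast hpl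
    have k2 := Nat.lt_floor_add_one (v' * (n - 1 : ℝ))
    nlinarith
  have lim : Tendsto (fun t : ℝ => s + t - (v - t) * (1 + (s + t))) (𝓝[>] 0)
      (𝓝 (s + 0 - (v - 0) * (1 + (s + 0)))) := by
    refine tendsto_nhdsWithin_of_tendsto_nhds (ContinuousAt.tendsto ?_)
    fun_prop
  have := ge_of_tendsto lim (by
    filter_upwards [Ioo_mem_nhdsGT hv] with t ht
    exact sub_nonneg.2 (key (v - t) (s + t) (by linarith [ht.2]) (by linarith [ht.1])
      (by linarith [ht.1])) : ∀ᶠ t in 𝓝[>] (0 : ℝ), 0 ≤ s + t - (v - t) * (1 + (s + t)))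
  simp only [sub_zero, add_zero] at this
  linarith

/-! ### Localisation and the upper bound. -/

/-- A Lindelöf argument on the image of $\Phi$: countably many of the given neighbourhoods suffice,
and dimension is stable under countable unions. -/
lemma dimH_le_of_local {Y : Type*} [TopologicalSpace Y] [SecondCountableTopology Y] {D : ℝ≥0∞}
    {S : Set ℝ} (Φ : ℝ → Y)
    (h : ∀ β ∈ S, ∃ U ∈ 𝓝 (Φ β), dimH {β' | β' ∈ S ∧ Φ β' ∈ U} ≤ D) : dimH S ≤ D := by
  choose! U hU hd using h
  choose! g hg using fun (y : Y) (hy : y ∈ Φ '' S) => hy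
  obtain ⟨T, hTS, hT, hcov⟩ := TopologicalSpace.countable_cover_nhdsWithin
    (s := Φ '' S) (f := fun y => U (g y)) fun y hy => mem_nhdsWithin_of_mem_nhds (by
      have := hU (g y) (hg y hy).1
      rwa [(hg y hy).2] at this)
  refine (dimH_mono (t := ⋃ y ∈ T, {β' | β' ∈ S ∧ Φ β' ∈ U (g y)}) fun β hβ => ?_).trans ?_
  · obtain ⟨y, hy, h⟩ := mem_iUnion₂.1 (hcov (mem_image_of_mem Φ hβ))
    exact mem_iUnion₂.2 ⟨y, hy, hβ, h⟩
  · rw [dimH_bUnion hT]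
    exact iSup₂_le fun y hy => hd _ (hg y (hTS hy)).1

/-- Near an infinite exponent the long final block alone suffices, so chains of length $0$ are used
with $s$ as large as needed. -/
lemma exists_nhds_dimH_le_of_eq_top {β : ℝ} (hβ : 1 < β) {D : ℝ≥0} (hD : 0 < D)
    (h : asymptoticExponent β 1 = ⊤) : ∃ U ∈ 𝓝 (asymptoticExponent β 1, β),
      dimH {β' | (asymptoticExponent β' 1, β') ∈ U} ≤ D := by
  set a := (1 + β) / 2 with ha
  have ha1 : 1 < a := by linarith
  have hla : 0 < D * Real.log a := mul_pos hD (Real.log_pos ha1)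
  obtain ⟨s, hs0, hs⟩ : ∃ s : ℝ, 0 ≤ s ∧ Real.log (β + 2) < (1 + s) * D * Real.log a := by
    refine ⟨Real.log (β + 2) / (D * Real.log a), div_nonneg (Real.log_nonneg (by linarith)) hla.le,
      ?_⟩
    rw [mul_assoc, add_mul, div_mul_cancel₀ _ hla.ne']; linarith
  refine ⟨Ioi (s : EReal) ×ˢ Ioo a (β + 1), prod_mem_nhds (by
    rw [h]; exact Ioi_mem_nhds (EReal.coe_lt_top s)) (Ioo_mem_nhds (by linarith) (by linarith)), ?_⟩
  refine dimH_le_of_chain (a := a) (b := β + 1) (B := β + 2) (v := 0) (ρ := 0) (s := s) (J := 0)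
    ha1 (by linarith) (by linarith) le_rfl le_rfl ?_ (by simpa using hs)
  rintro β' ⟨h1, h2⟩
  exact (frequently_zeros (ha1.trans h2.1) hs0 h1).mono fun n hn => ⟨⟨h2.1.le, h2.2.le⟩, hn⟩

/-- At $(s,\beta)$ itself a long enough chain gives a strict inequality between the exponents;
continuity in a common perturbation $t$ of all the data keeps it on a neighbourhood. -/
lemma exists_nhds_dimH_le_of_eq_coe {β v s : ℝ} (hβ : 1 < β) {D : ℝ≥0} (hv : 0 < v) (hvs : v < s)
    (h : asymptoticExponent β 1 = s) (hD : (s - v - v * s) / ((s - v) * (1 + s)) < D) :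
    ∃ U ∈ 𝓝 (asymptoticExponent β 1, β),
      dimH {β' | (v : EReal) ≤ uniformExponent β' 1 ∧ (asymptoticExponent β' 1, β') ∈ U} ≤ D := by
  have hs : 0 < s := by linarith
  obtain ⟨J, hJ⟩ : ∃ J : ℕ, 1 - v * ∑ i ∈ Finset.range J, (v / s) ^ i < (1 + s) * D := by
    have lim : Tendsto (fun J : ℕ => 1 - v * ∑ i ∈ Finset.range J, (v / s) ^ i) atTop
        (𝓝 (1 - v * (1 - v / s)⁻¹)) :=
      (((hasSum_geometric_of_lt_one (by positivity)
        ((div_lt_one hs).2 hvs)).tendsto_sum_nat).const_mul v).const_sub 1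
    refine (lim.eventually_lt_const ?_).exists
    have hsv : 0 < s - v := by linarith
    rw [div_lt_iff₀ (by positivity)] at hD
    have e : 1 - v * (1 - v / s)⁻¹ = (s - v - v * s) / (s - v) := by
      have : 1 - v / s = (s - v) / s := by field_simp
      rw [this, inv_div]; field_simp
    rw [e, div_lt_iff₀ hsv]
    linarith
  have hcont : ContinuousAt (fun t : ℝ => (1 + (s - t)) * D * Real.log (β - t) -
      (1 - (v - t) * ∑ i ∈ Finset.range J, ((v - t) / (s + t)) ^ i) * Real.log (β + 2 * t)) 0 := by
    have e1 : s + 0 ≠ 0 := by linarith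
    have e2 : β - 0 ≠ 0 := by linarith
    have e3 : β + 2 * 0 ≠ 0 := by linarith
    have c1 : ContinuousAt (fun t : ℝ => Real.log (β - t)) 0 :=
      ContinuousAt.log (by fun_prop) e2
    have c2 : ContinuousAt (fun t : ℝ => Real.log (β + 2 * t)) 0 :=
      ContinuousAt.log (by fun_prop) e3
    have c3 : ContinuousAt (fun t : ℝ => (v - t) / (s + t)) 0 :=
      ContinuousAt.div (by fun_prop) (by fun_prop) e1
    fun_prop
  have hpos : ∀ᶠ t in 𝓝 (0 : ℝ), 0 < (1 + (s - t)) * D * Real.log (β - t) -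
      (1 - (v - t) * ∑ i ∈ Finset.range J, ((v - t) / (s + t)) ^ i) * Real.log (β + 2 * t) := by
    refine hcont.eventually_const_lt ?_
    simp only [sub_zero, add_zero, mul_zero]
    rw [← sub_mul]
    exact mul_pos (by linarith) (Real.log_pos hβ)
  obtain ⟨t, ht, ht0, ht1⟩ := ((hpos.filter_mono nhdsWithin_le_nhds).and
    (Ioo_mem_nhdsGT (show 0 < min (β - 1) v by simp [hβ, hv]))).exists
  have ht2 := lt_min_iff.1 ht1
  refine ⟨Ioo ((s - t : ℝ) : EReal) ((s + t : ℝ) : EReal) ×ˢ Ioo (β - t) (β + t), prod_mem_nhds (by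
    rw [h]; exact Ioo_mem_nhds (EReal.coe_lt_coe_iff.2 (by linarith))
      (EReal.coe_lt_coe_iff.2 (by linarith))) (Ioo_mem_nhds (by linarith) (by linarith)), ?_⟩
  refine dimH_le_of_chain (a := β - t) (b := β + t) (B := β + 2 * t) (v := v - t)
    (ρ := (v - t) / (s + t)) (s := s - t) (J := J) (by linarith) (by linarith) (by linarith)
    (by linarith) (div_nonneg (by linarith) (by linarith)) ?_ (sub_pos.1 ht)
  rintro β' ⟨h0, ⟨h1, h1'⟩, h2⟩
  exact frequently_mem_chain (by linarith [h2.1]) (by linarith) (by linarith) (by linarith)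
    ((EReal.coe_lt_coe_iff.2 (by linarith)).trans_le h0) h1 h1'
    (mem_Icc.2 ⟨h2.1.le, h2.2.le⟩) J

/-- The upper bound for the dimension of a set of parameters. -/
lemma dimH_le_of_exponents {v : ℝ} (hv : 0 < v) {S : Set ℝ}
    (hS : ∀ β ∈ S, 1 < β ∧ (v : EReal) ≤ uniformExponent β 1) {D : ℝ≥0} (hD : 0 < D)
    (hg : ∀ β ∈ S, ∀ s : ℝ, v < s → asymptoticExponent β 1 = s →
      (s - v - v * s) / ((s - v) * (1 + s)) < D) : dimH S ≤ D := by
  refine dimH_le_of_local (fun β => (asymptoticExponent β 1, β)) fun β hβ => ?_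
  obtain ⟨h1, h2⟩ := hS β hβ
  cases h : asymptoticExponent β 1 with
  | bot => have := asymptoticExponent_nonneg h1
           simp [h] at this
  | top =>
    obtain ⟨U, hU, hd⟩ := exists_nhds_dimH_le_of_eq_top h1 hD h
    rw [← h]
    exact ⟨U, hU, (dimH_mono fun β' hβ' => hβ'.2).trans hd⟩
  | coe s =>
    have hvs := mul_one_add_le_of_exponents h1 hv h2 h
    have hs : 0 < s := by
      have : (0 : EReal) ≤ s := h ▸ asymptoticExponent_nonneg h1
      have : 0 ≤ s := by exact_mod_cast this
      nlinarith
    have hvs' : v < s := by nlinarith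
    obtain ⟨U, hU, hd⟩ := exists_nhds_dimH_le_of_eq_coe h1 hv hvs' h (hg β hβ s hvs' h)
    rw [← h]
    exact ⟨U, hU, (dimH_mono (show _ ⊆ {β' | _ ∧ _} from
      fun β' hβ' => ⟨(hS β' hβ'.1).2, hβ'.2⟩)).trans hd⟩

/-! ### Bases with prescribed digits and their separation. -/

lemma digit_tail_le {q : ℕ} {e : ℕ → ℕ} (he : ∀ i, e i ≤ q) {y : ℝ} (hy : 0 ≤ y) (hy1 : y < 1) :
    Summable (fun i => (e i : ℝ) * y ^ (i + 1)) ∧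
      ∑' i, (e i : ℝ) * y ^ (i + 1) ≤ q * (y / (1 - y)) := by
  have h1 : HasSum (fun i : ℕ => (q : ℝ) * y ^ (i + 1)) (q * (y / (1 - y))) := by
    have := ((hasSum_geometric_of_lt_one hy hy1).mul_left y).mul_left (q : ℝ)
    simpa only [pow_succ', div_eq_mul_inv] using this
  have h2 : ∀ i, (e i : ℝ) * y ^ (i + 1) ≤ q * y ^ (i + 1) := fun i =>
    mul_le_mul_of_nonneg_right (by exact_mod_cast he i) (by positivity)
  have h3 := Summable.of_nonneg_of_le (fun i => by positivity) h2 h1.summable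
  exact ⟨h3, (h3.tsum_le_tsum h2 h1.summable).trans h1.tsum_eq.le⟩

lemma digit_tail_succ {q : ℕ} {e : ℕ → ℕ} (he : ∀ i, e i ≤ q) {y : ℝ} (hy : 0 ≤ y)
    (hy1 : y < 1) : ∑' i, (e i : ℝ) * y ^ (i + 1) =
      y * (e 0 + ∑' i, (e (i + 1) : ℝ) * y ^ (i + 1)) := by
  rw [(digit_tail_le he hy hy1).1.tsum_eq_zero_add, mul_add, ← tsum_mul_left]
  congr 1
  · ring
  · exact tsum_congr fun i => by ring

/-- A sequence whose first digit is large is the expansion of `1` in some base. -/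
lemma exists_base {q : ℕ} {e : ℕ → ℕ} (h0 : e 0 = q + 2) (he : ∀ i, e (i + 1) ≤ q) :
    ∃ β : ℝ, (q + 2 : ℝ) ≤ β ∧ β ≤ q + 3 ∧ (∀ n, dig β n = e n) ∧
      ∀ n, orb β (n + 1) ≤ q / (q + 1) := by
  have he2 : ∀ i, e i ≤ q + 2 := by
    rintro (_ | i)
    · exact h0.le
    · have := he i; omega
  have hq : (0 : ℝ) ≤ q := Nat.cast_nonneg q
  -- The base is $1/y$ for a solution of $\sum_i e_i y^{i+1}=1$, found by the intermediate value
  -- theorem.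
  have hcont : ContinuousOn (fun y : ℝ => ∑' i, (e i : ℝ) * y ^ (i + 1))
      (Icc ((q + 3 : ℝ)⁻¹) ((q + 2 : ℝ)⁻¹)) := by
    refine continuousOn_tsum (u := fun i : ℕ => ((q + 2 : ℕ) : ℝ) * ((q + 2 : ℝ)⁻¹) ^ (i + 1))
      (fun i => by fun_prop) (digit_tail_le (e := fun _ => q + 2) (fun _ => le_rfl) (by positivity)
        (inv_lt_one_of_one_lt₀ (by linarith))).1 fun i y hy => ?_
    have hy0 : 0 ≤ y := le_trans (by positivity) hy.1
    rw [Real.norm_of_nonneg (by positivity)]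
    have := he2 i
    gcongr
    exact hy.2
  have hlow : ∑' i, (e i : ℝ) * ((q + 3 : ℝ)⁻¹) ^ (i + 1) ≤ 1 := by
    have hy1 : ((q + 3 : ℝ)⁻¹) < 1 := inv_lt_one_of_one_lt₀ (by linarith)
    rw [digit_tail_succ he2 (by positivity) hy1]
    have := (digit_tail_le he (by positivity) hy1).2
    have e1 : (q : ℝ) * ((q + 3 : ℝ)⁻¹ / (1 - (q + 3 : ℝ)⁻¹)) = q / (q + 2) := by
      have : (1 : ℝ) - (q + 3 : ℝ)⁻¹ = (q + 2) / (q + 3) := by field_simp; ring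
      rw [this]; field_simp
    rw [e1] at this
    have e2 : (q : ℝ) / (q + 2) ≤ 1 := (div_le_one (by positivity)).2 (by linarith)
    rw [h0, inv_mul_le_iff₀ (by positivity)]
    push_cast
    linarith
  have hhigh : 1 ≤ ∑' i, (e i : ℝ) * ((q + 2 : ℝ)⁻¹) ^ (i + 1) := by
    have hy1 : ((q + 2 : ℝ)⁻¹) < 1 := inv_lt_one_of_one_lt₀ (by linarith)
    rw [digit_tail_succ he2 (by positivity) hy1, h0, mul_add]
    have : (q + 2 : ℝ)⁻¹ * ((q + 2 : ℕ) : ℝ) = 1 := by push_cast; field_simp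
    rw [this]
    have : 0 ≤ ∑' i, (e (i + 1) : ℝ) * ((q + 2 : ℝ)⁻¹) ^ (i + 1) :=
      tsum_nonneg fun i => by positivity
    have : 0 ≤ (q + 2 : ℝ)⁻¹ * ∑' i, (e (i + 1) : ℝ) * ((q + 2 : ℝ)⁻¹) ^ (i + 1) := by positivity
    linarith
  obtain ⟨y, hy, hy1⟩ := intermediate_value_Icc
    (inv_anti₀ (by positivity) (by linarith : (q + 2 : ℝ) ≤ q + 3)) hcont ⟨hlow, hhigh⟩
  simp only at hy1
  have hy0 : 0 < y := lt_of_lt_of_le (by positivity) hy.1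
  have hylt : y < 1 := hy.2.trans_lt (inv_lt_one_of_one_lt₀ (by linarith))
  have hβ2 : (q + 2 : ℝ) ≤ y⁻¹ := (le_inv_comm₀ (by positivity) hy0).2 hy.2
  -- Later tails are at most $q/(\beta-1)\le q/(q+1)<1$, so each digit is the integer part and no
  -- lexicographic condition arises.
  have htail : ∀ n, 0 ≤ ∑' i, (e (n + 1 + i) : ℝ) * y ^ (i + 1) ∧
      ∑' i, (e (n + 1 + i) : ℝ) * y ^ (i + 1) ≤ q / (q + 1) := by
    refine fun n => ⟨tsum_nonneg fun i => by positivity, ?_⟩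
    refine (digit_tail_le (fun i => by simpa [add_right_comm] using he (n + i)) hy0.le
      hylt).2.trans ?_
    rw [div_eq_mul_inv (q : ℝ)]
    refine mul_le_mul_of_nonneg_left ?_ hq
    rw [← inv_div]
    refine inv_anti₀ (by positivity) ?_
    rw [sub_div, div_self hy0.ne', one_div]
    linarith
  have horb : ∀ n, orb y⁻¹ n = ∑' i, (e (n + i) : ℝ) * y ^ (i + 1) ∧ dig y⁻¹ n = e n := by
    have hd : ∀ n, orb y⁻¹ n = ∑' i, (e (n + i) : ℝ) * y ^ (i + 1) →
        y⁻¹ * orb y⁻¹ n = e n + ∑' i, (e (n + 1 + i) : ℝ) * y ^ (i + 1) ∧ dig y⁻¹ n = e n := by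
      intro n hn
      have h1 : y⁻¹ * orb y⁻¹ n = e n + ∑' i, (e (n + 1 + i) : ℝ) * y ^ (i + 1) := by
        rw [hn, digit_tail_succ (e := fun i => e (n + i)) (fun i => he2 (n + i)) hy0.le hylt,
          inv_mul_cancel_left₀ hy0.ne']
        simp only [add_zero, add_assoc, add_comm 1]
      refine ⟨h1, ?_⟩
      rw [dig, h1, Int.floor_eq_iff]
      have : (q : ℝ) / (q + 1) < 1 := (div_lt_one (by positivity)).2 (by linarith)
      constructor <;> push_cast <;> linarith [htail n]
    intro n
    induction n with
    | zero =>
      have : orb y⁻¹ 0 = ∑' i, (e (0 + i) : ℝ) * y ^ (i + 1) := by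
        simp only [zero_add, hy1, orb_zero]
      exact ⟨this, (hd 0 this).2⟩
    | succ n ih =>
      obtain ⟨h1, h2⟩ := hd n ih.1
      have : orb y⁻¹ (n + 1) = ∑' i, (e (n + 1 + i) : ℝ) * y ^ (i + 1) := by
        rw [orb_succ, h1, h2]; push_cast; ring
      exact ⟨this, (hd (n + 1) this).2⟩
  refine ⟨y⁻¹, hβ2, (inv_le_comm₀ hy0 (by positivity)).2 hy.1, fun n => (horb n).2, fun n => ?_⟩
  rw [(horb (n + 1)).1]
  exact (htail n).2

lemma abs_mul_orb_sub_le {q β β' : ℝ} (hq : 0 ≤ q) (hβ' : 0 ≤ β') (hβ'q : β' ≤ q + 3) (n : ℕ)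
    (hd : ∀ i < n, dig β i = dig β' i) :
    |β * orb β n - β' * orb β' n| ≤ |β - β'| * ((q + 3) ^ (n + 1) - 1) := by
  have step : ∀ x, |orb β n - orb β' n| ≤ |β - β'| * x →
      |β * orb β n - β' * orb β' n| ≤ |β - β'| * ((q + 3) * x + 1) := by
    intro x hx
    have : β * orb β n - β' * orb β' n = (β - β') * orb β n + β' * (orb β n - orb β' n) := by ring
    rw [this]
    refine (abs_add_le _ _).trans ?_
    rw [abs_mul, abs_mul, abs_of_nonneg hβ', abs_of_nonneg (orb_nonneg β n)]
    have k1 := mul_le_of_le_one_right (abs_nonneg (β - β')) (orb_le_one β n)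
    have k2 : β' * |orb β n - orb β' n| ≤ (q + 3) * (|β - β'| * x) :=
      mul_le_mul hβ'q hx (abs_nonneg _) (by linarith)
    linarith
  -- The term $-1$ in the bound is what lets the induction absorb the extra $+1$ of each step.
  have h2 : ∀ m : ℕ, (q + 3) * ((q + 3) ^ m - 1) + 1 ≤ (q + 3) ^ (m + 1) - 1 := fun m => by
    rw [pow_succ']; linarith
  refine (step ((q + 3) ^ n - 1) ?_).trans (mul_le_mul_of_nonneg_left (h2 n) (abs_nonneg _))
  clear step
  induction n with
  | zero => simp [orb_zero]
  | succ n ih =>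
    have ih := ih fun i hi => hd i (by omega)
    have : orb β (n + 1) - orb β' (n + 1) =
        (β - β') * orb β n + β' * (orb β n - orb β' n) := by
      rw [orb_succ, orb_succ, hd n (by omega)]; ring
    rw [this]
    refine (abs_add_le _ _).trans ?_
    rw [abs_mul, abs_mul, abs_of_nonneg hβ', abs_of_nonneg (orb_nonneg β n)]
    have k1 := mul_le_of_le_one_right (abs_nonneg (β - β')) (orb_le_one β n)
    have k2 : β' * |orb β n - orb β' n| ≤ (q + 3) * (|β - β'| * ((q + 3) ^ n - 1)) :=
      mul_le_mul hβ'q ih (abs_nonneg _) (by linarith)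
    have := mul_le_mul_of_nonneg_left (h2 n) (abs_nonneg (β - β'))
    linarith

/-- Parameters with different digits are separated. -/
lemma separation {q β β' : ℝ} (hq : 0 ≤ q) (hβ' : 0 ≤ β') (hβ'q : β' ≤ q + 3) {n : ℕ}
    (hd : ∀ i < n, dig β i = dig β' i) (hn : dig β n ≠ dig β' n)
    (h1 : orb β (n + 1) ≤ q / (q + 1)) (h2 : orb β' (n + 1) ≤ q / (q + 1)) :
    1 / (q + 1) ≤ |β - β'| * (q + 3) ^ (n + 1) := by
  have k1 := abs_mul_orb_sub_le hq hβ' hβ'q n hd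
  have k2 : (1 : ℝ) ≤ |(dig β n : ℝ) - dig β' n| := by
    exact_mod_cast Int.one_le_abs (sub_ne_zero.2 hn)
  have k3 := orb_succ_nonneg β n
  have k4 := orb_succ_nonneg β' n
  have e1 : β * orb β n = dig β n + orb β (n + 1) := by rw [orb_succ]; ring
  have e2 : β' * orb β' n = dig β' n + orb β' (n + 1) := by rw [orb_succ]; ring
  have e3 : 1 / (q + 1) = 1 - q / (q + 1) := by field_simp; ring
  -- Integer parts differ by at least $1$, while both fractional parts lie in $[0,q/(q+1)]$.
  have k5 : 1 / (q + 1) ≤ |β * orb β n - β' * orb β' n| := by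
    rw [e1, e2, e3]
    rcases le_abs.1 k2 with h | h
    · exact le_trans (by linarith) (le_abs_self _)
    · exact le_trans (by linarith) (neg_le_abs _)
  linarith [abs_nonneg (β - β')]

lemma one_le_orb_mul_of_dig_ne_zero {β : ℝ} (hβ : 1 < β) {n i : ℕ} (h : n ≤ i)
    (hd : dig β i ≠ 0) : 1 ≤ orb β n * β ^ (i - n + 1) := by
  by_contra hlt
  exact hd (dig_eq_zero_of_lt hβ (not_le.1 hlt) h (by omega))

lemma orb_mul_pow_le_one {β : ℝ} {n m : ℕ} (h : n ≤ m)
    (hd : ∀ i, n ≤ i → i < m → dig β i = 0) : orb β n * β ^ (m - n) ≤ 1 := by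
  have : orb β m = orb β n * β ^ (m - n) := by
    induction m, h using Nat.le_induction with
    | base => simp
    | succ m hm ih =>
      rw [orb_succ, ih fun i hi hi' => hd i hi (by omega), hd m hm (by omega),
        Nat.succ_sub hm, pow_succ]
      push_cast; ring
  rw [← this]; exact orb_le_one β m

/-! ### Geometric blocks of zeros and the exponents they produce. -/

/-- The positions `i` with `θ ^ k < i + 1 ≤ (1 + u) * θ ^ k` for some `k ≥ k₀`. -/
def zeroPos (u θ : ℝ) (k₀ : ℕ) (i : ℕ) : Prop :=
  ∃ k ≥ k₀, θ ^ k < (i + 1 : ℝ) ∧ (i + 1 : ℝ) ≤ (1 + u) * θ ^ k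

lemma exists_gap {u θ : ℝ} (hu : 0 < u) (hθ : 1 + u < θ) :
    ∃ k₀ : ℕ, ∀ k ≥ k₀, (1 + u) * θ ^ k + 1 ≤ θ ^ (k + 1) := by
  obtain ⟨k₀, h⟩ := eventually_atTop.1 ((tendsto_pow_atTop_atTop_of_one_lt
    (show 1 < θ by linarith)).eventually_ge_atTop (1 / (θ - 1 - u)))
  refine ⟨k₀, fun k hk => ?_⟩
  have := h k hk
  rw [div_le_iff₀ (by linarith)] at this
  rw [pow_succ]; linarith

section
variable {u θ β : ℝ} {k₀ : ℕ}

/-- Digits are indexed from $0$, so this floor is the first index after the $k$-th block; `hk₀`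
keeps the next block away from it. -/
lemma not_zeroPos_floor (hu : 0 < u) (hθ : 1 + u < θ)
    (hk₀ : ∀ k ≥ k₀, (1 + u) * θ ^ k + 1 ≤ θ ^ (k + 1)) {k : ℕ} (hk : k₀ ≤ k) :
    ¬ zeroPos u θ k₀ ⌊(1 + u) * θ ^ k⌋₊ := by
  rintro ⟨j, -, h1, h2⟩
  have h3 := Nat.lt_floor_add_one ((1 + u) * θ ^ k)
  have h4 := Nat.floor_le (show 0 ≤ (1 + u) * θ ^ k by
    have : 0 < θ := by linarith
    positivity)
  rcases le_or_gt j k with h | h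
  · have : θ ^ j ≤ θ ^ k := pow_le_pow_right₀ (by linarith) h
    nlinarith
  · have : θ ^ (k + 1) ≤ θ ^ j := pow_le_pow_right₀ (by linarith) h
    linarith [hk₀ k hk]

lemma orb_lower (hu : 0 < u) (hθ : 1 + u < θ)
    (hk₀ : ∀ k ≥ k₀, (1 + u) * θ ^ k + 1 ≤ θ ^ (k + 1)) (hβ : 1 < β)
    (hd : ∀ i, ¬ zeroPos u θ k₀ i → dig β i ≠ 0) (n : ℕ) :
    1 ≤ orb β n * β ^ (1 : ℝ) ∨
      ∃ k ≥ k₀, θ ^ k < (n + 1 : ℝ) ∧ 1 ≤ orb β n * β ^ (u * θ ^ k + 2) := by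
  by_cases hz : zeroPos u θ k₀ n
  swap
  · left; simpa using one_le_orb_mul_of_dig_ne_zero hβ le_rfl (hd n hz)
  right
  obtain ⟨k, hk, h1, h2⟩ := hz
  refine ⟨k, hk, h1, ?_⟩
  have hn : n ≤ ⌊(1 + u) * θ ^ k⌋₊ := Nat.le_floor (by linarith)
  refine (one_le_orb_mul_of_dig_ne_zero hβ hn (hd _ (not_zeroPos_floor hu hθ hk₀ hk))).trans ?_
  rw [← Real.rpow_natCast]
  refine mul_le_mul_of_nonneg_left (Real.rpow_le_rpow_of_exponent_le hβ.le ?_) (orb_nonneg _ _)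
  push_cast [Nat.cast_sub hn]
  have h4 := Nat.floor_le (show 0 ≤ (1 + u) * θ ^ k by
    have : 0 < θ := by linarith
    positivity)
  linarith

lemma orb_upper (hu : 0 < u) (hθ : 1 + u < θ) (hβ : 1 < β)
    (hd : ∀ i, zeroPos u θ k₀ i → dig β i = 0) {k : ℕ} (hk : k₀ ≤ k) :
    orb β ⌊θ ^ k⌋₊ * β ^ (u * θ ^ k - 1) ≤ 1 := by
  have hpos : 0 < θ ^ k := pow_pos (by linarith) k
  have h1 := Nat.floor_le hpos.le
  have h4 := Nat.floor_le (show 0 ≤ (1 + u) * θ ^ k by positivity)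
  have h5 := Nat.lt_floor_add_one ((1 + u) * θ ^ k)
  have hle : ⌊θ ^ k⌋₊ ≤ ⌊(1 + u) * θ ^ k⌋₊ := Nat.floor_le_floor (by nlinarith)
  refine le_trans ?_ (orb_mul_pow_le_one hle fun i hi hi' => hd i ⟨k, hk, ?_, ?_⟩)
  · rw [← Real.rpow_natCast β]
    refine mul_le_mul_of_nonneg_left (Real.rpow_le_rpow_of_exponent_le hβ.le ?_) (orb_nonneg _ _)
    push_cast [Nat.cast_sub hle]
    linarith
  · have : ((⌊θ ^ k⌋₊ : ℕ) : ℝ) ≤ i := by exact_mod_cast hi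
    linarith [Nat.lt_floor_add_one (θ ^ k)]
  · exact le_trans (by exact_mod_cast hi') h4

lemma tendsto_floor_pow (hθ : 1 < θ) : Tendsto (fun k : ℕ => ⌊θ ^ k⌋₊) atTop atTop :=
  tendsto_nat_floor_atTop.comp (tendsto_pow_atTop_atTop_of_one_lt hθ)

lemma orb_mul_rpow_lt {x y : ℝ} {n : ℕ} (hβ : 1 < β) (h : orb β n * β ^ x ≤ 1)
    (hxy : y < x) : orb β n * β ^ y < 1 := by
  rcases (orb_nonneg β n).eq_or_lt with h0 | h0
  · rw [← h0]; simp
  · exact (mul_lt_mul_of_pos_left (Real.rpow_lt_rpow_of_exponent_lt hβ hxy) h0).trans_le h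

lemma one_le_orb_mul_rpow {x y : ℝ} {n : ℕ} (hβ : 1 < β) (h : 1 ≤ orb β n * β ^ x)
    (hxy : x ≤ y) : 1 ≤ orb β n * β ^ y :=
  h.trans (mul_le_mul_of_nonneg_left (Real.rpow_le_rpow_of_exponent_le hβ.le hxy)
    (orb_nonneg _ _))

lemma asymptoticExponent_eq_of_zeroPos (hu : 0 < u) (hθ : 1 + u < θ)
    (hk₀ : ∀ k ≥ k₀, (1 + u) * θ ^ k + 1 ≤ θ ^ (k + 1)) (hβ : 1 < β)
    (hd : ∀ i, dig β i = 0 ↔ zeroPos u θ k₀ i) : asymptoticExponent β 1 = u := by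
  rw [asymptoticExponent_eq hβ]
  refine le_antisymm (sSup_le ?_) (le_of_forall_lt fun c hc => ?_)
  · rintro _ ⟨w, hw, rfl⟩
    refine EReal.coe_le_coe_iff.2 (le_of_not_gt fun huw => hw ?_)
    have : Tendsto (fun n : ℕ => (w - u) * (n : ℝ)) atTop atTop :=
      tendsto_natCast_atTop_atTop.const_mul_atTop (by linarith)
    filter_upwards [this.eventually_ge_atTop (u + 2)] with n hn
    rintro ⟨-, h⟩
    refine h.not_ge ?_
    rcases orb_lower hu hθ hk₀ hβ (fun i hi h0 => hi ((hd i).1 h0)) n with h1 | ⟨k, -, h2, h1⟩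
    · exact one_le_orb_mul_rpow hβ h1 (by nlinarith [(Nat.cast_nonneg n : (0 : ℝ) ≤ n)])
    · exact one_le_orb_mul_rpow hβ h1 (by nlinarith)
  · obtain ⟨w, h1, h2⟩ := EReal.lt_iff_exists_real_btwn.1 hc
    refine h1.trans_le (le_sSup ⟨w, ?_, rfl⟩)
    have hwu : w < u := EReal.coe_lt_coe_iff.1 h2
    refine frequently_atTop.2 fun X => ?_
    have hlim := tendsto_floor_pow (show 1 < θ by linarith)
    have : Tendsto (fun k : ℕ => (u - w) * ((⌊θ ^ k⌋₊ : ℕ) : ℝ)) atTop atTop :=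
      (tendsto_natCast_atTop_atTop.comp hlim).const_mul_atTop (by linarith)
    obtain ⟨k, ⟨⟨hk1, hk2⟩, hk3⟩, hk4⟩ := (((this.eventually_gt_atTop 1).and
      (hlim.eventually_ge_atTop X)).and (hlim.eventually_ge_atTop 1)).and
      (eventually_ge_atTop k₀) |>.exists
    refine ⟨_, hk2, hk3, orb_mul_rpow_lt hβ (orb_upper hu hθ hβ (fun i => (hd i).2) hk4) ?_⟩
    have := Nat.floor_le (show 0 ≤ θ ^ k from (pow_pos (by linarith) k).le)
    nlinarith

/-- The worst $N$ lies just before $\theta^{k+1}$, where the smallest available value is still about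
$\beta^{-u\theta^k}=\beta^{-(u/\theta)\theta^{k+1}}$. -/
lemma uniformExponent_eq_of_zeroPos (hu : 0 < u) (hθ : 1 + u < θ)
    (hk₀ : ∀ k ≥ k₀, (1 + u) * θ ^ k + 1 ≤ θ ^ (k + 1)) (hβ : 1 < β)
    (hd : ∀ i, dig β i = 0 ↔ zeroPos u θ k₀ i) :
    uniformExponent β 1 = ((u / θ : ℝ) : EReal) := by
  have hθ0 : 0 < θ := by linarith
  have huθ : u / θ * θ = u := div_mul_cancel₀ _ hθ0.ne'
  have huθ0 : 0 < u / θ := by positivity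
  rw [uniformExponent_eq hβ]
  refine le_antisymm (sSup_le ?_) (le_of_forall_lt fun c hc => ?_)
  · rintro _ ⟨w, hw, rfl⟩
    refine EReal.coe_le_coe_iff.2 (le_of_not_gt fun huw => ?_)
    have hlim : Tendsto (fun k : ℕ => ⌊θ ^ (k + 1)⌋₊ - 1) atTop atTop :=
      (tendsto_sub_atTop_nat 1).comp
        ((tendsto_floor_pow (show 1 < θ by linarith)).comp (tendsto_add_atTop_nat 1))
    have h2 : Tendsto (fun k : ℕ => (w - u / θ) * ((⌊θ ^ (k + 1)⌋₊ - 1 : ℕ) : ℝ)) atTop atTop :=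
      (tendsto_natCast_atTop_atTop.comp hlim).const_mul_atTop (by linarith)
    obtain ⟨k, ⟨n, hn1, hnN, hn⟩, hk⟩ := ((hlim.eventually hw).and
      (h2.eventually_ge_atTop (2 * (u / θ) + 2))).exists
    have hfl := Nat.floor_le (show 0 ≤ θ ^ (k + 1) from (pow_pos hθ0 _).le)
    have hfl2 := Nat.lt_floor_add_one (θ ^ (k + 1))
    obtain ⟨N, hN⟩ : ∃ N, ⌊θ ^ (k + 1)⌋₊ = N + 1 := ⟨⌊θ ^ (k + 1)⌋₊ - 1, by omega⟩
    simp only [hN, Nat.add_sub_cancel] at hn hk hnN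
    rw [hN] at hfl hfl2
    push_cast at hfl hfl2
    have hnN' : (n : ℝ) ≤ N := by exact_mod_cast hnN
    have hN0 : (0 : ℝ) ≤ N := Nat.cast_nonneg N
    refine hn.not_ge ?_
    rcases orb_lower hu hθ hk₀ hβ (fun i hi h0 => hi ((hd i).1 h0)) n with h1 | ⟨j, -, h3, h1⟩
    · exact one_le_orb_mul_rpow hβ h1 (by nlinarith)
    · refine one_le_orb_mul_rpow hβ h1 ?_
      have hjk : j ≤ k := by
        by_contra hlt
        have : θ ^ (k + 1) ≤ θ ^ j := pow_le_pow_right₀ (by linarith) (by omega)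
        linarith
      have e1 : θ ^ j ≤ θ ^ k := pow_le_pow_right₀ (by linarith) hjk
      have e2 : u * θ ^ k = u / θ * θ ^ (k + 1) := by rw [pow_succ']; field_simp
      have e3 := mul_le_mul_of_nonneg_left e1 hu.le
      have e4 := mul_le_mul_of_nonneg_left hfl2.le huθ0.le
      nlinarith
  · obtain ⟨w, h1, h2⟩ := EReal.lt_iff_exists_real_btwn.1 hc
    refine h1.trans_le (le_sSup ⟨w, ?_, rfl⟩)
    have hwu : w < u / θ := EReal.coe_lt_coe_iff.1 h2
    have : Tendsto (fun n : ℕ => (u / θ - w) * (n : ℝ)) atTop atTop :=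
      tendsto_natCast_atTop_atTop.const_mul_atTop (by linarith)
    filter_upwards [this.eventually_gt_atTop 1, eventually_ge_atTop 1,
      tendsto_natCast_atTop_atTop.eventually_ge_atTop (θ ^ k₀)] with N hN1 hN2 hN3
    obtain ⟨k, hk1, hk2⟩ := exists_nat_pow_near (x := (N : ℝ)) (by exact_mod_cast hN2)
      (show 1 < θ by linarith)
    have hk : k₀ ≤ k := Nat.lt_succ_iff.1
      ((pow_lt_pow_iff_right₀ (show 1 < θ by linarith)).1 (hN3.trans_lt hk2))
    refine ⟨⌊θ ^ k⌋₊, Nat.le_floor (by simpa using one_le_pow₀ (by linarith)), ?_,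
      orb_mul_rpow_lt hβ (orb_upper hu hθ hβ (fun i => (hd i).2) hk) ?_⟩
    · exact_mod_cast (Nat.floor_le (pow_pos hθ0 k).le).trans hk1
    · have e2 : u * θ ^ k = u / θ * θ ^ (k + 1) := by rw [pow_succ']; field_simp
      have e4 := mul_le_mul_of_nonneg_left hk2.le huθ0.le
      linarith
end

/-! ### Density of the free positions. -/

lemma card_le_of_forall_mem {s : Finset ℕ} {x y : ℝ} (hx : 0 ≤ x) (hxy : x ≤ y)
    (h : ∀ i ∈ s, x < (i + 1 : ℝ) ∧ (i + 1 : ℝ) ≤ y) : (s.card : ℝ) ≤ y - x + 1 := by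
  have hsub : s ⊆ Finset.Ico ⌊x⌋₊ ⌊y⌋₊ := fun i hi => by
    obtain ⟨h1, h2⟩ := h i hi
    have k1 : ⌊x⌋₊ < i + 1 := by
      have := (Nat.floor_le hx).trans_lt h1
      exact_mod_cast this
    have k2 : i + 1 ≤ ⌊y⌋₊ := Nat.le_floor (by push_cast; exact h2)
    exact Finset.mem_Ico.2 ⟨by omega, k2⟩
  have hc := Finset.card_le_card hsub
  rw [Nat.card_Ico] at hc
  have hle : ⌊x⌋₊ ≤ ⌊y⌋₊ := Nat.floor_le_floor hxy
  have : (s.card : ℝ) ≤ (⌊y⌋₊ : ℝ) - ⌊x⌋₊ := by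
    rw [← Nat.cast_sub hle]; exact_mod_cast hc
  linarith [Nat.floor_le (hx.trans hxy), Nat.lt_floor_add_one x]

-- The proportion of free positions is least at the end of a block, $N\approx(1+u)\theta^k$, where
-- summing the earlier blocks gives this coefficient. One unit per block is lost to rounding.
open Classical in
lemma sub_le_count {u θ : ℝ} (hu : 0 < u) (hθ : 1 + u < θ) (k₀ k N : ℕ) (h1 : θ ^ k ≤ N)
    (h2 : N < θ ^ (k + 1)) :
    (θ - 1 - u) / ((1 + u) * (θ - 1)) * N - k - 2 ≤
      Nat.count (fun i => 1 ≤ i ∧ ¬ zeroPos u θ k₀ i) N := by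
  set p : ℕ → Prop := fun i => 1 ≤ i ∧ ¬ zeroPos u θ k₀ i with hp
  have hθ1 : 0 < θ - 1 := by linarith
  have hθ0 : 0 < θ := by linarith
  set y : ℝ := min N ((1 + u) * θ ^ k) with hy
  set Z : ℕ → ℝ → Finset ℕ := fun j y =>
    (Finset.range N).filter fun i => θ ^ j < (i + 1 : ℝ) ∧ (i + 1 : ℝ) ≤ y with hZ
  have hZc : ∀ j y, θ ^ j ≤ y → ((Z j y).card : ℝ) ≤ y - θ ^ j + 1 := fun j y hjy =>
    card_le_of_forall_mem (pow_pos hθ0 j).le hjy fun i hi => (Finset.mem_filter.1 hi).2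
  have hsub : (Finset.range N).filter (fun i => ¬ p i) ⊆
      {0} ∪ ((Finset.range k).biUnion (fun j => Z j ((1 + u) * θ ^ j)) ∪ Z k y) := by
    intro i hi
    obtain ⟨hiN, hpi⟩ := Finset.mem_filter.1 hi
    simp only [Finset.mem_union, Finset.mem_singleton, Finset.mem_biUnion]
    rcases Nat.eq_zero_or_pos i with h0 | h0
    · exact Or.inl h0
    have hz : zeroPos u θ k₀ i := by
      by_contra hz
      exact hpi ⟨h0, hz⟩
    obtain ⟨j, -, hj1, hj2⟩ := hz
    have hiN' : (i + 1 : ℝ) ≤ N := by exact_mod_cast Finset.mem_range.1 hiN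
    have hjk : j < k + 1 := (pow_lt_pow_iff_right₀ (show 1 < θ by linarith)).1 (by linarith)
    rcases Nat.lt_succ_iff_lt_or_eq.1 hjk with hlt | rfl
    · exact Or.inr (Or.inl ⟨j, Finset.mem_range.2 hlt, Finset.mem_filter.2 ⟨hiN, hj1, hj2⟩⟩)
    · exact Or.inr (Or.inr (Finset.mem_filter.2 ⟨hiN, hj1, le_min hiN' hj2⟩))
  have hyk : θ ^ k ≤ y := le_min h1 (by nlinarith [pow_pos hθ0 k])
  have hcard : (((Finset.range N).filter (fun i => ¬ p i)).card : ℝ) ≤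
      1 + ((∑ j ∈ Finset.range k, (u * θ ^ j + 1)) + (y - θ ^ k + 1)) := by
    have k1 := (Finset.card_le_card hsub).trans (Finset.card_union_le _ _)
    have k2 := Finset.card_union_le ((Finset.range k).biUnion fun j => Z j ((1 + u) * θ ^ j))
      (Z k y)
    have k3 := Finset.card_biUnion_le (s := Finset.range k) (t := fun j => Z j ((1 + u) * θ ^ j))
    rw [Finset.card_singleton] at k1
    have k4 : (((Finset.range N).filter (fun i => ¬ p i)).card : ℝ) ≤
        1 + ((∑ j ∈ Finset.range k, ((Z j ((1 + u) * θ ^ j)).card : ℝ)) + (Z k y).card) := by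
      exact_mod_cast k1.trans (by omega)
    refine k4.trans ?_
    gcongr with j hj
    · refine (hZc j _ (by nlinarith [pow_pos hθ0 j])).trans (by linarith)
    · exact hZc k y hyk
  have hsum : ∑ j ∈ Finset.range k, (u * θ ^ j + 1) = u * ((θ ^ k - 1) / (θ - 1)) + k := by
    rw [Finset.sum_add_distrib, ← Finset.mul_sum, geom_sum_eq (by linarith)]
    simp
  have hcount : (Nat.count p N : ℝ) + ((Finset.range N).filter (fun i => ¬ p i)).card = N := by
    rw [Nat.count_eq_card_filter_range]
    have := Finset.card_filter_add_card_filter_not (s := Finset.range N) p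
    rw [Finset.card_range] at this
    exact_mod_cast this
  have hmain : (θ - 1 - u) / ((1 + u) * (θ - 1)) * N ≤
      N - u * (θ ^ k / (θ - 1)) - (y - θ ^ k) := by
    have hk0 := pow_pos hθ0 k
    -- After the $k$-th block or inside it, the surplus is a nonnegative multiple of the distance
    -- from $N$ to the end of the block.
    rcases le_total ((1 + u) * θ ^ k) N with h | h
    · rw [hy, min_eq_right h]
      have e : (N : ℝ) - u * (θ ^ k / (θ - 1)) - ((1 + u) * θ ^ k - θ ^ k) -
          (θ - 1 - u) / ((1 + u) * (θ - 1)) * N =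
          u * θ / ((1 + u) * (θ - 1)) * (N - (1 + u) * θ ^ k) := by
        field_simp; ring
      have : 0 ≤ u * θ / ((1 + u) * (θ - 1)) * (N - (1 + u) * θ ^ k) :=
        mul_nonneg (by positivity) (by linarith)
      linarith
    · rw [hy, min_eq_left h]
      have e : (N : ℝ) - u * (θ ^ k / (θ - 1)) - (N - θ ^ k) -
          (θ - 1 - u) / ((1 + u) * (θ - 1)) * N =
          (θ - 1 - u) / ((1 + u) * (θ - 1)) * ((1 + u) * θ ^ k - N) := by
        field_simp; ring
      have : 0 ≤ (θ - 1 - u) / ((1 + u) * (θ - 1)) * ((1 + u) * θ ^ k - N) :=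
        mul_nonneg (div_nonneg (by linarith) (by positivity)) (by linarith)
      linarith
  have : u * ((θ ^ k - 1) / (θ - 1)) ≤ u * (θ ^ k / (θ - 1)) := by
    gcongr; linarith
  linarith

open Classical in
/-- The density of the positions outside the blocks of zeros. -/
lemma exists_le_count {u θ σ : ℝ} (hu : 0 < u) (hθ : 1 + u < θ) (k₀ : ℕ)
    (hσ : σ < (θ - 1 - u) / ((1 + u) * (θ - 1))) :
    ∃ C : ℝ, ∀ N : ℕ, σ * N - C ≤ Nat.count (fun i => 1 ≤ i ∧ ¬ zeroPos u θ k₀ i) N := by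
  set g := (θ - 1 - u) / ((1 + u) * (θ - 1)) with hg
  have hlim := tendsto_pow_const_div_const_pow_of_one_lt 1 (show 1 < θ by linarith)
  obtain ⟨K, hK⟩ := eventually_atTop.1 (hlim.eventually_lt_const (show 0 < g - σ by linarith))
  refine ⟨K + 2, fun N => ?_⟩
  rcases Nat.eq_zero_or_pos N with rfl | hN
  · simp; linarith [(Nat.cast_nonneg K : (0 : ℝ) ≤ K)]
  obtain ⟨k, h1, h2⟩ := exists_nat_pow_near (x := (N : ℝ)) (by exact_mod_cast hN)
    (show 1 < θ by linarith)
  refine le_trans ?_ (sub_le_count hu hθ k₀ k N h1 h2)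
  have hk : (k : ℝ) ≤ (g - σ) * N + K := by
    rcases le_total K k with h | h
    · have := hK k h
      rw [pow_one, div_lt_iff₀ (pow_pos (by linarith) k)] at this
      have := mul_le_mul_of_nonneg_left h1 (show 0 ≤ g - σ by linarith)
      linarith [(Nat.cast_nonneg K : (0 : ℝ) ≤ K)]
    · have : (k : ℝ) ≤ K := by exact_mod_cast h
      have : 0 ≤ (g - σ) * N := mul_nonneg (by linarith) (Nat.cast_nonneg N)
      linarith
  linarith

/-! ### Hölder coding and the lower bound. -/

lemma holderOnWith_of_abs_sub_le {f : ℝ → ℝ} {s : Set ℝ} {K : ℝ} (hK : 0 ≤ K) {r : ℝ≥0}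
    (h : ∀ x ∈ s, ∀ y ∈ s, |f x - f y| ≤ K * |x - y| ^ (r : ℝ)) :
    HolderOnWith K.toNNReal r f s := by
  intro x hx y hy
  rw [edist_dist, edist_dist, Real.dist_eq, Real.dist_eq,
    ENNReal.ofReal_rpow_of_nonneg (abs_nonneg _) r.coe_nonneg]
  change _ ≤ ENNReal.ofReal K * _
  rw [← ENNReal.ofReal_mul hK]
  exact ENNReal.ofReal_le_ofReal (h x hx y hy)

open Classical in
/-- The digits with prescribed zeros whose other digits encode the base `q` expansion of `x`. -/
noncomputable def codedDigit (q : ℕ) [NeZero q] (z : ℕ → Prop) (x : ℝ) (i : ℕ) : ℕ :=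
  if i = 0 then q + 2 else if z i then 0 else
    1 + (Real.digits x q (Nat.count (fun j => 1 ≤ j ∧ ¬ z j) i) : ℕ)

open Classical in
lemma abs_sub_le_of_codedDigit {q : ℕ} [NeZero q] (hq : 1 < q) {z : ℕ → Prop} {x x' : ℝ}
    (hx : x ∈ Ico (0 : ℝ) 1) (hx' : x' ∈ Ico (0 : ℝ) 1) {N : ℕ}
    (h : ∀ i < N, codedDigit q z x i = codedDigit q z x' i) :
    |x - x'| ≤ ((q : ℝ) ^ Nat.count (fun j => 1 ≤ j ∧ ¬ z j) N)⁻¹ := by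
  rw [← Real.ofDigits_digits hq hx, ← Real.ofDigits_digits hq hx']
  refine Real.abs_ofDigits_sub_ofDigits_le fun m hm => ?_
  set p : ℕ → Prop := fun j => 1 ≤ j ∧ ¬ z j with hp
  have hlt := Nat.nth_lt_of_lt_count hm
  have hmem : p (Nat.nth p m) := Nat.nth_mem m fun hf => hm.trans_le (by
    rw [Nat.count_eq_card_filter_range]
    exact Finset.card_le_card fun i hi => by
      simpa using (Finset.mem_filter.1 hi).2)
  have hc : Nat.count p (Nat.nth p m) = m := Nat.count_nth fun hf => hm.trans_le (by
    rw [Nat.count_eq_card_filter_range]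
    exact Finset.card_le_card fun i hi => by
      simpa using (Finset.mem_filter.1 hi).2)
  have := h _ hlt
  simp only [codedDigit, if_neg hmem.2, if_neg (Nat.one_le_iff_ne_zero.1 hmem.1), ← hp, hc] at this
  exact Fin.ext (by omega)

open Classical in
lemma codedDigit_succ_le (q : ℕ) [NeZero q] (z : ℕ → Prop) (x : ℝ) (i : ℕ) :
    codedDigit q z x (i + 1) ≤ q := by
  simp only [codedDigit, Nat.succ_ne_zero, if_false]
  split_ifs
  · omega
  · have := (Real.digits x q (Nat.count (fun j => 1 ≤ j ∧ ¬ z j) (i + 1))).2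
    omega

lemma codedDigit_eq_zero_iff (q : ℕ) [NeZero q] {z : ℕ → Prop} (hz : ¬ z 0) (x : ℝ) (i : ℕ) :
    codedDigit q z x i = 0 ↔ z i := by
  simp only [codedDigit]
  split_ifs with h1 h2
  · subst h1; simp [hz]
  · simp [h2]
  · simp [h2]

open Classical in
/-- A set that contains all parameters with prescribed positions of the zero digits has a large
dimension when these positions are sparse. -/
lemma le_dimH_of_digits {q : ℕ} (hq : 1 < q) {z : ℕ → Prop} (hz : ¬ z 0) {σ C : ℝ} (hσ : 0 < σ)
    (hcount : ∀ N : ℕ, σ * N - C ≤ Nat.count (fun j => 1 ≤ j ∧ ¬ z j) N) {S : Set ℝ}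
    (hS : ∀ β : ℝ, 1 < β → (∀ i, dig β i = 0 ↔ z i) → β ∈ S) {r : ℝ≥0} (hr : 0 < r)
    (hrσ : r * Real.log (q + 3) ≤ σ * Real.log q) : (r : ℝ≥0∞) ≤ dimH S := by
  have : NeZero q := ⟨by omega⟩
  have hq1 : (1 : ℝ) < q := by exact_mod_cast hq
  have hq0 : (0 : ℝ) < q := by linarith
  choose B hB1 hB2 hB3 hB4 using fun x : ℝ =>
    exists_base (q := q) (e := codedDigit q z x) (by simp [codedDigit]) (codedDigit_succ_le q z x)
  -- Agreement up to $N$ fixes at least $\sigma N-C$ base $q$ digits of $x$.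
  have key : ∀ x ∈ Ico (0 : ℝ) 1, ∀ N, (∀ x' ∈ Ico (0 : ℝ) 1,
      (∀ i < N, codedDigit q z x i = codedDigit q z x' i) →
      |x - x'| * (q : ℝ) ^ (σ * N) ≤ (q : ℝ) ^ C) := by
    intro x hx N x' hx' h
    have k1 := abs_sub_le_of_codedDigit hq hx hx' h
    rw [← one_div, le_div_iff₀ (by positivity), ← Real.rpow_natCast] at k1
    have k2 : (q : ℝ) ^ (σ * N - C) ≤
        (q : ℝ) ^ ((Nat.count (fun j => 1 ≤ j ∧ ¬ z j) N : ℕ) : ℝ) :=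
      Real.rpow_le_rpow_of_exponent_le hq1.le (hcount N)
    have k3 := (mul_le_mul_of_nonneg_left k2 (abs_nonneg (x - x'))).trans k1
    rwa [Real.rpow_sub hq0, ← mul_div_assoc, div_le_one (by positivity)] at k3
  set K : ℝ := (q : ℝ) ^ C * (((q : ℝ) + 1) * (q + 3)) ^ (r : ℝ) with hK
  have hold : ∀ x ∈ Ico (0 : ℝ) 1, ∀ x' ∈ Ico (0 : ℝ) 1,
      |x - x'| ≤ K * |B x - B x'| ^ (r : ℝ) := by
    intro x hx x' hx'
    by_cases hne : ∃ N, codedDigit q z x N ≠ codedDigit q z x' N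
    · have hN := Nat.find_spec hne
      have hlt : ∀ i < Nat.find hne, codedDigit q z x i = codedDigit q z x' i := fun i hi =>
        not_not.1 (Nat.find_min hne hi)
      set N := Nat.find hne
      have k1 := key x hx N x' hx' hlt
      have k2 := separation (q := q) (β := B x) (β' := B x') (n := N) hq0.le
        (by linarith [hB1 x']) (hB2 x') (fun i hi => by rw [hB3, hB3, hlt i hi])
        (by rw [hB3, hB3]; exact_mod_cast hN) (hB4 x N) (hB4 x' N)
      have k3 : 1 ≤ (((q : ℝ) + 1) * (q + 3)) * |B x - B x'| * (q + 3) ^ N := by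
        rw [div_le_iff₀ (by positivity), pow_succ] at k2
        linarith
      have k4 : ((q : ℝ) + 3) ^ ((r : ℝ) * N) ≤ (q : ℝ) ^ (σ * N) := by
        rw [Real.rpow_def_of_pos hq0, Real.rpow_def_of_pos (by positivity)]
        refine Real.exp_le_exp.2 ?_
        have := mul_le_mul_of_nonneg_right hrσ (Nat.cast_nonneg (α := ℝ) N)
        linarith
      have k5 : 1 ≤ (((q : ℝ) + 1) * (q + 3)) ^ (r : ℝ) * |B x - B x'| ^ (r : ℝ) *
          (q : ℝ) ^ (σ * N) := by
        have := Real.one_le_rpow k3 r.2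
        rw [Real.mul_rpow (by positivity) (by positivity), Real.mul_rpow (by positivity)
          (by positivity), ← Real.rpow_natCast, ← Real.rpow_mul (by positivity),
          mul_comm (N : ℝ)] at this
        exact this.trans (mul_le_mul_of_nonneg_left k4 (by positivity))
      have hpos : 0 < (q : ℝ) ^ (σ * N) := by positivity
      refine le_of_mul_le_mul_right ?_ hpos
      calc |x - x'| * (q : ℝ) ^ (σ * N) ≤ (q : ℝ) ^ C * 1 := by linarith
        _ ≤ (q : ℝ) ^ C * ((((q : ℝ) + 1) * (q + 3)) ^ (r : ℝ) * |B x - B x'| ^ (r : ℝ) *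
          (q : ℝ) ^ (σ * N)) := mul_le_mul_of_nonneg_left k5 (by positivity)
        _ = _ := by rw [hK]; ring
    · push Not at hne
      have h0 : |x - x'| ≤ 0 := by
        by_contra hlt
        push Not at hlt
        obtain ⟨N, hN⟩ := ((tendsto_rpow_mul_natCast hq1 hσ).eventually_gt_atTop
          ((q : ℝ) ^ C / |x - x'|)).exists
        rw [div_lt_iff₀ hlt] at hN
        linarith [key x hx N x' hx' fun i _ => hne i]
      exact h0.trans (by positivity)
  -- The Hölder estimate bounds $x$ by its base, so it is the inverse of `B` that is Hölder; it maps
  -- the constructed bases onto $[0,1)$, of dimension $1$.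
  set F := Function.invFunOn B (Ico (0 : ℝ) 1) with hF
  have hFmem : ∀ β ∈ B '' Ico (0 : ℝ) 1, F β ∈ Ico (0 : ℝ) 1 ∧ B (F β) = β := fun β hβ =>
    ⟨Function.invFunOn_mem hβ, Function.invFunOn_eq hβ⟩
  have hFH : HolderOnWith K.toNNReal r F (B '' Ico (0 : ℝ) 1) :=
    holderOnWith_of_abs_sub_le (by positivity) fun β hβ β' hβ' => by
      have := hold _ (hFmem β hβ).1 _ (hFmem β' hβ').1
      rwa [(hFmem β hβ).2, (hFmem β' hβ').2] at this
  have himg : Ico (0 : ℝ) 1 ⊆ F '' (B '' Ico (0 : ℝ) 1) := by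
    intro x hx
    refine ⟨B x, mem_image_of_mem B hx, ?_⟩
    obtain ⟨h1, h2⟩ := hFmem _ (mem_image_of_mem B hx)
    have := hold _ h1 _ hx
    rw [h2, sub_self, abs_zero, Real.zero_rpow (by exact_mod_cast hr.ne'), mul_zero] at this
    exact sub_eq_zero.1 (abs_eq_zero.1 (le_antisymm this (abs_nonneg _)))
  have hsub : B '' Ico (0 : ℝ) 1 ⊆ S := by
    rintro _ ⟨x, -, rfl⟩
    refine hS _ (by linarith [hB1 x]) fun i => ?_
    rw [hB3, ← codedDigit_eq_zero_iff q hz x i]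
    norm_cast
  have h1 : dimH (Ico (0 : ℝ) 1) = 1 := by
    rw [Real.dimH_of_nonempty_interior (by simp)]; simp
  have h2 : 1 ≤ dimH S / r := by
    rw [← h1]
    exact ((dimH_mono himg).trans (hFH.dimH_image_le hr)).trans
      (ENNReal.div_le_div_right (dimH_mono hsub) _)
  rwa [ENNReal.le_div_iff_mul_le (Or.inl (by exact_mod_cast hr.ne')) (Or.inl ENNReal.coe_ne_top),
    one_mul] at h2

/-- The lower bound for the dimension of the set of parameters with given exponents. -/
lemma le_dimH_of_exponents {θ v : ℝ} (hθ0 : 0 < θ) (hv : 0 < v) (hθ : 1 + θ * v < θ) {r : ℝ≥0}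
    (hr : (r : ℝ) < (θ - 1 - θ * v) / ((1 + θ * v) * (θ - 1))) :
    (r : ℝ≥0∞) ≤ dimH ({β : ℝ | 1 < β ∧ uniformExponent β 1 = (v : EReal)} ∩
        {β : ℝ | 1 < β ∧ asymptoticExponent β 1 = ((θ * v : ℝ) : EReal)}) := by
  rcases eq_zero_or_pos r with rfl | hr0
  · simp
  have hu : 0 < θ * v := by positivity
  obtain ⟨k₀, hk₀⟩ := exists_gap hu hθ
  obtain ⟨σ, hrσ, hσ⟩ := exists_between hr
  obtain ⟨C, hC⟩ := exists_le_count hu hθ k₀ hσ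
  have hr0' : (0 : ℝ) < r := hr0
  -- As $q+3\le4q$, a large $q$ makes $r\log(q+3)\le\sigma\log q$.
  have hlim : Tendsto (fun q : ℕ => (σ - r) * Real.log q) atTop atTop :=
    (Real.tendsto_log_atTop.comp tendsto_natCast_atTop_atTop).const_mul_atTop (by linarith)
  obtain ⟨q, hq1, hq2⟩ := ((eventually_gt_atTop 1).and
    (hlim.eventually_ge_atTop (r * Real.log 4))).exists
  have hq0 : (1 : ℝ) < q := by exact_mod_cast hq1
  have hlog : Real.log (q + 3) ≤ Real.log 4 + Real.log q := by
    rw [← Real.log_mul (by norm_num) (by linarith)]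
    exact Real.log_le_log (by linarith) (by linarith)
  refine le_dimH_of_digits hq1 (z := zeroPos (θ * v) θ k₀) ?_ (hr0'.trans hrσ) hC ?_ hr0 ?_
  · rintro ⟨k, -, h, -⟩
    have : 1 ≤ θ ^ k := one_le_pow₀ (by linarith)
    norm_num at h
    linarith
  · intro β hβ hd
    have := uniformExponent_eq_of_zeroPos hu hθ hk₀ hβ hd
    rw [mul_div_cancel_left₀ _ hθ0.ne'] at this
    exact ⟨⟨hβ, this⟩, hβ, asymptoticExponent_eq_of_zeroPos hu hθ hk₀ hβ hd⟩
  · nlinarith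

/-! ### Optimisation over the exponent and conclusion. -/

lemma le_ofReal_of_forall_lt {a : ℝ≥0∞} {x : ℝ} (h : ∀ D : ℝ≥0, 0 < D → x < D → a ≤ D) :
    a ≤ ENNReal.ofReal x := by
  refine le_of_forall_gt_imp_ge_of_dense fun c hc => ?_
  obtain ⟨D, h1, h2⟩ := ENNReal.lt_iff_exists_nnreal_btwn.1 hc
  have hD : 0 < D := ENNReal.coe_pos.1 (pos_of_gt h1)
  refine (h D hD (lt_of_not_ge fun hge => h1.not_ge ?_)).trans h2.le
  rw [← ENNReal.ofReal_coe_nnreal]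
  exact ENNReal.ofReal_le_ofReal hge

/-- After clearing denominators the difference is the square $((1-v)s-2v)^2$, with equality at
$s=2v/(1-v)$. -/
lemma dimension_formula_le {v s : ℝ} (hv : 0 < v) (hvs : v < s) :
    (s - v - v * s) / ((s - v) * (1 + s)) ≤ ((1 - v) / (1 + v)) ^ 2 := by
  have hsv : 0 < s - v := by linarith
  have hs : 0 < s := by linarith
  rw [div_pow, div_le_div_iff₀ (by positivity) (by positivity)]
  nlinarith [sq_nonneg ((1 - v) * s - 2 * v)]

lemma dimH_uniformExponent_ge_le {v : ℝ} (hv : 0 < v) :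
    dimH {β : ℝ | 1 < β ∧ (v : EReal) ≤ uniformExponent β 1} ≤
      ENNReal.ofReal (((1 - v) / (1 + v)) ^ 2) :=
  le_ofReal_of_forall_lt fun _ hD hlt => dimH_le_of_exponents hv (fun _ h => h) hD
    fun _ _ _ hvs _ => (dimension_formula_le hv hvs).trans_lt hlt

lemma ofReal_le_dimH_of_exponents {θ v : ℝ} (hv : 0 < v) (hv1 : v < 1) (hθ : 1 / (1 - v) ≤ θ) :
    ENNReal.ofReal ((θ - 1 - θ * v) / ((1 + θ * v) * (θ - 1))) ≤
      dimH ({β : ℝ | 1 < β ∧ uniformExponent β 1 = (v : EReal)} ∩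
        {β : ℝ | 1 < β ∧ asymptoticExponent β 1 = ((θ * v : ℝ) : EReal)}) := by
  have hθ0 : 0 < θ := lt_of_lt_of_le (one_div_pos.2 (by linarith)) hθ
  rw [div_le_iff₀ (by linarith)] at hθ
  rcases (show 1 + θ * v ≤ θ by linarith).eq_or_lt with h | h
  · have : θ - 1 - θ * v = 0 := by linarith
    simp [this]
  · refine ENNReal.le_of_forall_nnreal_lt fun r hr => le_dimH_of_exponents hθ0 hv h ?_
    exact (ENNReal.lt_ofReal_iff_toReal_lt ENNReal.coe_ne_top).1 hr

theorem theorem1p6 (θ v : ℝ) (hθ : 0 < θ) (hv : 0 < v) (hv1 : v < 1) :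
    (θ < 1 / (1 - v) →
      {β : ℝ | 1 < β ∧ (v : EReal) ≤ uniformExponent β 1} ∩
        {β : ℝ | 1 < β ∧ asymptoticExponent β 1 = ((θ * v : ℝ) : EReal)} = ∅) ∧
    (1 / (1 - v) ≤ θ →
      dimH ({β : ℝ | 1 < β ∧ uniformExponent β 1 = (v : EReal)} ∩
        {β : ℝ | 1 < β ∧ asymptoticExponent β 1 = ((θ * v : ℝ) : EReal)}) =
        ENNReal.ofReal ((θ - 1 - θ * v) / ((1 + θ * v) * (θ - 1)))) ∧
    dimH {β : ℝ | 1 < β ∧ (v : EReal) ≤ uniformExponent β 1} =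
      ENNReal.ofReal (((1 - v) / (1 + v)) ^ 2) ∧
    dimH {β : ℝ | 1 < β ∧ uniformExponent β 1 = 1} = 0 := by
  have h1v : 0 < 1 - v := by linarith
  refine ⟨fun h => ?_, fun h => le_antisymm ?_ (ofReal_le_dimH_of_exponents hv hv1 h),
    le_antisymm (dimH_uniformExponent_ge_le hv) ?_, ?_⟩
  · rw [eq_empty_iff_forall_notMem]
    rintro β ⟨⟨hβ, h1⟩, -, h2⟩
    have := mul_one_add_le_of_exponents hβ hv h1 h2
    rw [lt_div_iff₀ h1v] at h
    nlinarith
  · refine le_ofReal_of_forall_lt fun D hD hlt => dimH_le_of_exponents hv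
      (fun β hβ => ⟨hβ.1.1, hβ.1.2.ge⟩) hD fun β hβ s hvs hs => ?_
    have hsθ : s = θ * v := by
      have := hβ.2.2
      rw [hs] at this
      exact_mod_cast this
    have hθ1 : 0 < θ - 1 := by nlinarith
    subst hsθ
    convert hlt using 1
    have : θ * v - v = v * (θ - 1) := by ring
    rw [this]
    field_simp
  -- The value $\theta=2/(1-v)$ gives $\theta v=2v/(1-v)$, the equality case of
  -- `dimension_formula_le`.
  · have h2 : 1 / (1 - v) ≤ 2 / (1 - v) := by gcongr; norm_num
    refine (le_of_eq ?_).trans ((ofReal_le_dimH_of_exponents hv hv1 h2).trans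
      (dimH_mono fun β hβ => ⟨hβ.1.1, hβ.1.2.ge⟩))
    congr 1
    have e1 : 2 / (1 - v) - 1 - 2 / (1 - v) * v = 1 := by field_simp; ring
    have e2 : 1 + 2 / (1 - v) * v = (1 + v) / (1 - v) := by field_simp; ring
    have e3 : 2 / (1 - v) - 1 = (1 + v) / (1 - v) := by field_simp; ring
    rw [e1, e2, e3]
    field_simp
  · refine le_antisymm ?_ bot_le
    rw [← ENNReal.ofReal_zero]
    refine le_ofReal_of_forall_lt fun D hD _ => ?_
    have hD' : (0 : ℝ) < D := hD
    -- As $w\to1$ the bound $((1-w)/(1+w))^2$ tends to $0$; the minimum with $1/2$ keeps $w$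
    -- positive.
    set w : ℝ := 1 - min (1 / 2) (D : ℝ) with hw
    have hw0 : 0 < w := by linarith [min_le_left (1 / 2 : ℝ) (D : ℝ)]
    have hw1 : w ≤ 1 := by linarith [le_min (by norm_num : (0 : ℝ) ≤ 1 / 2) hD'.le]
    have hwD : 1 - w ≤ D := by linarith [min_le_right (1 / 2 : ℝ) (D : ℝ)]
    have hsub : {β : ℝ | 1 < β ∧ uniformExponent β 1 = 1} ⊆
        {β : ℝ | 1 < β ∧ (w : EReal) ≤ uniformExponent β 1} := fun β hβ =>
      ⟨hβ.1, by rw [hβ.2]; exact_mod_cast hw1⟩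
    refine (dimH_mono hsub).trans ((dimH_uniformExponent_ge_le hw0).trans
      (ENNReal.ofReal_le_of_le_toReal ?_))
    have h3 : (1 - w) / (1 + w) ≤ 1 - w := div_le_self (by linarith) (by linarith)
    have h4 : 0 ≤ (1 - w) / (1 + w) := div_nonneg (by linarith) (by linarith)
    change ((1 - w) / (1 + w)) ^ 2 ≤ (D : ℝ)
    nlinarith
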